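/- Work in $\mathbb{R}^3$. For a measurable set $A\subset\mathbb{R}^3$ let $|A|$ be its Lebesgue measure and $P(A)=\sup\{\int_A \operatorname{div}\varphi : \varphi\in C^1_c(\mathbb{R}^3;\mathbb{R}^3),\ |\varphi|\le 1\}$ its perimeter, and for a nonnegative measurable kernel $G$ on $\mathbb{R}^3$ set $$\mathcal{E}_G(A)=P(A)+\int_A\int_A G(x-y)\,dx\,dy .$$ Let $B_R\subset\mathbb{R}^3$ be the ball of radius $R$ centred at $0$ and let $C_{l,L}=\{x\in\mathbb{R}^3 : \sqrt{x_1^2+x_2^2}<l,\ 0<x_3<L\}$. Define $$\rho^{\mathrm{ball}}_G=\inf_{R>0}\frac{\mathcal{E}_G(B_R)}{|B_R|},\qquad \sigma^{\mathrm{cyl}}_G(l)=\lim_{L\to\infty}\frac{\mathcal{E}_G(C_{l,L})}{|C_{l,L}|}\quad(l>0),\qquad \rho^{\mathrm{cyl}}_G=\inf_{l>0}\sigma^{\mathrm{cyl}}_G(l).$$ For $\kappa>0$ consider the truncated Coulomb kernel $R_{1,\kappa}(x)=\mathbf{1}_{|x|<\kappa}|x|^{-1}$ and the Yukawa kernel $Y_{1,\kappa}(x)=e^{-|x|/\kappa}|x|^{-1}$.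 For $G=R_{1,\kappa}$ and for $G=Y_{1,\kappa}$, with any $\kappa>0$, the limit defining $\sigma^{\mathrm{cyl}}_G(l)$ exists for every $l>0$. For each of the two families there exists $\kappa>0$ such that $$\rho^{\mathrm{cyl}}_G<\rho^{\mathrm{ball}}_G .$$ Concretely, this inequality holds for $G=R_{1,\kappa}$ with $\kappa=11/10$ and for $G=Y_{1,\kappa}$ with $\kappa=0.56$. -/

import Mathlib

open Filter Topology MeasureTheory
open scoped ENNReal

noncomputable section

namespace LiquidDrop

/-- The Euclidean space `ℝⁿ`, with its Euclidean norm and Lebesgue measure. -/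
abbrev E (n : ℕ) : Type := EuclideanSpace ℝ (Fin n)

/-- The divergence `∑ᵢ ∂ᵢ φᵢ` of a (differentiable) vector field on `ℝⁿ`. -/
def divergence {n : ℕ} (φ : E n → E n) (x : E n) : ℝ :=
  ∑ i : Fin n, (fderiv ℝ φ x (EuclideanSpace.single i 1)) i

/-- The (De Giorgi) perimeter of a measurable set `A ⊆ ℝⁿ`: the supremum of `∫_A div φ` over all
compactly supported `C¹` vector fields `φ` with `|φ| ≤ 1` everywhere. The choice `φ = 0` makes the
supremum nonnegative, so that the truncation in `ENNReal.ofReal` does not change it. -/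
def perimeter {n : ℕ} (A : Set (E n)) : ℝ≥0∞ :=
  ⨆ (φ : E n → E n) (_ : ContDiff ℝ 1 φ) (_ : HasCompactSupport φ) (_ : ∀ x, ‖φ x‖ ≤ 1),
    ENNReal.ofReal (∫ x in A, divergence φ x)

/-- The self-interaction `∫_{A × A} G(x - y) dx dy` for a nonnegative kernel `G`, in `[0, ∞]`. -/
def interaction {n : ℕ} (G : E n → ℝ) (A : Set (E n)) : ℝ≥0∞ :=
  ∫⁻ x in A, ∫⁻ y in A, ENNReal.ofReal (G (x - y))

/-- The energy: perimeter plus self-interaction. -/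
def energy {n : ℕ} (G : E n → ℝ) (A : Set (E n)) : ℝ≥0∞ :=
  perimeter A + interaction G A

/-- The energy per unit of mass. -/
def energyPerMass {n : ℕ} (G : E n → ℝ) (A : Set (E n)) : ℝ≥0∞ :=
  energy G A / volume A

/-- The optimal energy/mass ratio of balls. -/
def rhoBall {n : ℕ} (G : E n → ℝ) : ℝ≥0∞ :=
  ⨅ (R : ℝ) (_ : 0 < R), energyPerMass G (Metric.ball (0 : E n) R)

/-- The round cylinder `B_l × (0, L)` in `ℝ³`, where `B_l` is the open disk of radius `l`
centred at `0` in the plane. -/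
def cylinder (l L : ℝ) : Set (E 3) :=
  {x | √(x 0 ^ 2 + x 1 ^ 2) < l ∧ x 2 ∈ Set.Ioo 0 L}

/-- The energy/mass ratio of the infinite cylinder of radius `l`: the limit as `L → ∞` of the
energy/mass ratio of the cylinder of radius `l` and length `L`. -/
def sigmaCyl (G : E 3 → ℝ) (l : ℝ) : ℝ≥0∞ :=
  limUnder atTop fun L : ℝ => energyPerMass G (cylinder l L)

/-- The optimal energy/mass ratio of infinite cylinders. -/
def rhoCyl (G : E 3 → ℝ) : ℝ≥0∞ :=
  ⨅ (l : ℝ) (_ : 0 < l), sigmaCyl G l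

open Classical in
/-- The truncated Coulomb kernel `R_{1,κ}(x) = 1_{|x| < κ} |x|⁻¹` on `ℝ³`. -/
def truncatedCoulomb (κ : ℝ) (x : E 3) : ℝ :=
  if ‖x‖ < κ then ‖x‖⁻¹ else 0

/-- The Yukawa kernel `Y_{1,κ}(x) = exp(-|x|/κ) |x|⁻¹` on `ℝ³`. -/
def yukawa (κ : ℝ) (x : E 3) : ℝ :=
  Real.exp (-‖x‖ / κ) * ‖x‖⁻¹

end LiquidDrop

end

noncomputable section

namespace LiquidDrop

open Metric Set


/-! Both inequalities are numerical: a rational number is placed between an upper bound for one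
well-chosen cylinder and a lower bound for all balls.

By Tonelli, the interaction of A is the integral of G(z) against |A ∩ (A + z)|
(`interaction_eq_lintegral_overlap`). For a cylinder this overlap is (L - |z₃|)₊ times the overlap
of two discs, so after division by the mass the interaction increases with L. The perimeter over the
mass tends to 2/l, so the limit exists for every measurable kernel
(`tendsto_energyPerMass_cylinder`) and is at most 2/l plus the interaction density of the infinite
cylinder.

The disc overlap involves an arcsine. It is bounded above through the odd polynomial `discMinorant`,
so for a radial kernel g(|x|) only integrals of g(|x|) |x'|^k remain, x' being the first two
coordinates. Polar coordinates reduce them to radial moments with explicit Gamma quotients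
(`rhoCyl_le_of_moments`), elementary for both kernels.

In ℝ³ the overlap of two balls is a cubic polynomial in |z|, and the field φ(x) = x/R, cut off,
bounds the perimeter below. This gives an explicit function of R below the energy per mass of balls
(`le_energyPerMass_ball`), which is then minimised. The separating values are 6.615 < 6.616 for the
truncated Coulomb kernel and 3.8743 < 3.8744 for the Yukawa kernel. -/

/-! ### Perimeter from above: integration by parts and Minkowski content -/

lemma contDiff_apply {n : ℕ} {φ : E n → E n} (hφ : ContDiff ℝ 1 φ) (i : Fin n) :
    ContDiff ℝ 1 fun x => φ x i :=
  (contDiff_piLp_apply 2 (i := i)).comp hφ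

lemma fderiv_apply_coord {n : ℕ} {φ : E n → E n} (hφ : ContDiff ℝ 1 φ) (i : Fin n) (x v : E n) :
    fderiv ℝ (fun x => φ x i) x v = (fderiv ℝ φ x v) i := by
  have h := ((EuclideanSpace.proj i : E n →L[ℝ] ℝ).hasFDerivAt (x := φ x)).comp x
    ((hφ.differentiable one_ne_zero) x).hasFDerivAt
  have h' : HasFDerivAt (fun x => φ x i)
    ((EuclideanSpace.proj i : E n →L[ℝ] ℝ).comp (fderiv ℝ φ x)) x := h
  rw [h'.fderiv]
  rfl

lemma hasCompactSupport_apply {n : ℕ} {φ : E n → E n} (hφ : HasCompactSupport φ) (i : Fin n) :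
    HasCompactSupport fun x => φ x i :=
  hφ.comp_left (g := fun y : E n => y i) rfl

lemma continuous_divergence {n : ℕ} {φ : E n → E n} (hφ : ContDiff ℝ 1 φ) :
    Continuous (divergence φ) := by
  unfold divergence
  refine continuous_finsetSum _ fun i _ => ?_
  have h : Continuous fun x => fderiv ℝ φ x (EuclideanSpace.single i 1) :=
    (hφ.continuous_fderiv one_ne_zero).clm_apply continuous_const
  exact (EuclideanSpace.proj i : E n →L[ℝ] ℝ).continuous.comp h

lemma hasCompactSupport_divergence {n : ℕ} {φ : E n → E n} (hc : HasCompactSupport φ) :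
    HasCompactSupport (divergence φ) :=
  (hc.fderiv (𝕜 := ℝ)).mono fun x hx => by
    contrapose! hx
    simp only [Function.mem_support, not_not] at hx
    simp [divergence, hx]

lemma integrable_divergence {n : ℕ} {φ : E n → E n} (hφ : ContDiff ℝ 1 φ)
    (hc : HasCompactSupport φ) : Integrable (divergence φ) :=
  (continuous_divergence hφ).integrable_of_hasCompactSupport (hasCompactSupport_divergence hc)

/-- Integration by parts of the divergence against a Lipschitz function. -/
lemma integral_divergence_mul {n : ℕ} {φ : E n → E n} (hφ : ContDiff ℝ 1 φ)
    (hc : HasCompactSupport φ) {C : NNReal} {η : E n → ℝ} (hη : LipschitzWith C η) :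
    ∫ x, divergence φ x * η x = - ∫ x, fderiv ℝ η x (φ x) := by
  have key : ∀ i : Fin n, Integrable (fun x => lineDeriv ℝ η x (EuclideanSpace.single i 1) * φ x i) ∧
      Integrable (fun x => (fderiv ℝ φ x (EuclideanSpace.single i 1)) i * η x) ∧
      ∫ x, (fderiv ℝ φ x (EuclideanSpace.single i 1)) i * η x =
        - ∫ x, lineDeriv ℝ η x (EuclideanSpace.single i 1) * φ x i := by
    intro i
    have hci := hasCompactSupport_apply hc i
    have hdi := contDiff_apply hφ i
    obtain ⟨D, hD⟩ := hdi.lipschitzWith_of_hasCompactSupport hci one_ne_zero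
    have h := hη.integral_lineDeriv_mul_eq (μ := volume) hD hci (EuclideanSpace.single i 1)
    refine ⟨?_, ?_, ?_⟩
    · refine (hdi.continuous.integrable_of_hasCompactSupport hci).bdd_mul
        (c := C * ‖(EuclideanSpace.single i 1 : E n)‖) ?_ ?_
      · exact (measurable_lineDeriv hη.continuous).aestronglyMeasurable
      · exact Eventually.of_forall fun x => norm_lineDeriv_le_of_lipschitz ℝ hη
    · refine Continuous.integrable_of_hasCompactSupport ?_ ?_
      · refine Continuous.mul ?_ hη.continuous
        have h : Continuous fun x => fderiv ℝ φ x (EuclideanSpace.single i 1) :=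
          (hφ.continuous_fderiv one_ne_zero).clm_apply continuous_const
        exact (EuclideanSpace.proj i : E n →L[ℝ] ℝ).continuous.comp h
      · refine (hc.fderiv (𝕜 := ℝ)).mono fun x hx => ?_
        contrapose! hx
        simp only [Function.mem_support, not_not] at hx
        simp [hx]
    · rw [h, ← integral_neg]
      refine integral_congr_ae (Eventually.of_forall fun x => ?_)
      have hd : DifferentiableAt ℝ (fun x => φ x i) x := hdi.differentiable one_ne_zero x
      simp only [hd.lineDeriv_eq_fderiv, map_neg, fderiv_apply_coord hφ, PiLp.neg_apply, neg_mul,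
        neg_neg]
  calc ∫ x, divergence φ x * η x
      = ∑ i : Fin n, ∫ x, (fderiv ℝ φ x (EuclideanSpace.single i 1)) i * η x := by
        rw [← integral_finsetSum _ fun i _ => (key i).2.1]
        simp only [divergence, Finset.sum_mul]
    _ = - ∫ x, ∑ i : Fin n, lineDeriv ℝ η x (EuclideanSpace.single i 1) * φ x i := by
        rw [integral_finsetSum _ fun i _ => (key i).1, ← Finset.sum_neg_distrib]
        exact Finset.sum_congr rfl fun i _ => (key i).2.2
    _ = - ∫ x, fderiv ℝ η x (φ x) := by
        congr 1
        refine integral_congr_ae ?_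
        filter_upwards [hη.ae_differentiableAt] with x hx
        simp only [hx.lineDeriv_eq_fderiv]
        conv_rhs => rw [← (EuclideanSpace.basisFun (Fin n) ℝ).sum_repr (φ x)]
        simp [mul_comm]

/-- The perimeter is at most the (one-sided) Minkowski content. -/
theorem perimeter_le_of_volume_thickening_le {n : ℕ} {A : Set (E n)} (hA : MeasurableSet A)
    (hne : A.Nonempty) {f : ℝ → ℝ} {M : ℝ} (hf : Tendsto f (𝓝[>] 0) (𝓝 M)) (hf0 : ∀ ε, 0 ≤ f ε)
    (hvol : ∀ ε > 0, volume (thickening ε A \ A) ≤ ENNReal.ofReal (ε * f ε)) :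
    perimeter A ≤ ENNReal.ofReal M := by
  refine iSup_le fun φ => iSup_le fun hφ => iSup_le fun hc => iSup_le fun hb => ?_
  apply ENNReal.ofReal_le_ofReal
  obtain ⟨B, hB⟩ := (continuous_divergence hφ).bounded_above_of_compact_support
    (hasCompactSupport_divergence hc)
  have hB0 : 0 ≤ B := (norm_nonneg _).trans (hB 0)
  have main : ∀ ε > 0, ∫ x in A, divergence φ x ≤ f ε + B * (ε * f ε) := by
    intro ε hε
    -- η is 1 on A and falls linearly to 0 across the shell T. Integrating by parts against η costs
    -- at most |T|/ε ≤ f ε; replacing the indicator of A by η costs at most B |T|, which vanishes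
    -- with ε.
    set η : E n → ℝ := fun x => max (1 - ε⁻¹ * infDist x A) 0 with hηdef
    set T : Set (E n) := thickening ε A \ A
    have hT : MeasurableSet T := isOpen_thickening.measurableSet.diff hA
    have hTfin : volume T ≠ ∞ := ((hvol ε hε).trans_lt ENNReal.ofReal_lt_top).ne
    have hTvol : volume.real T ≤ ε * f ε :=
      ENNReal.toReal_le_of_le_ofReal (mul_nonneg hε.le (hf0 ε)) (hvol ε hε)
    have hηlip : LipschitzWith (Real.toNNReal ε⁻¹) η := by
      refine LipschitzWith.of_dist_le_mul fun x y => ?_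
      rw [Real.coe_toNNReal _ (inv_nonneg.2 hε.le), Real.dist_eq]
      refine (abs_max_sub_max_le_abs _ _ _).trans ?_
      rw [show 1 - ε⁻¹ * infDist x A - (1 - ε⁻¹ * infDist y A)
        = ε⁻¹ * (infDist y A - infDist x A) by ring, abs_mul, abs_of_pos (inv_pos.2 hε)]
      gcongr
      rw [← Real.dist_eq, dist_comm x y]
      exact (lipschitz_infDist_pt A).dist_le_mul _ _ |>.trans (by simp)
    have hη0 : ∀ x, 0 ≤ η x := fun x => le_max_right _ _
    have hη1 : ∀ x, η x ≤ 1 := fun x =>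
      max_le (by have := mul_nonneg (inv_nonneg.2 hε.le) (infDist_nonneg (x := x) (s := A)); linarith)
        zero_le_one
    have hηA : ∀ x ∈ A, η x = 1 := fun x hx => by simp [hηdef, infDist_zero_of_mem hx]
    have hηout : ∀ x, x ∉ thickening ε A → η x = 0 := by
      intro x hx
      rw [mem_thickening_iff_infDist_lt hne, not_lt] at hx
      apply max_eq_right
      have : 1 ≤ ε⁻¹ * infDist x A := by
        rw [inv_mul_eq_div, le_div_iff₀ hε]; simpa using hx
      linarith
    -- Off T the function η attains its maximum 1 or its minimum 0, so its derivative vanishes;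
    -- where η is not differentiable, `fderiv` is 0 by convention. The bound thus holds at every
    -- point, including those of the boundary.
    have hfd : ∀ x, ‖fderiv ℝ η x (φ x)‖ ≤ T.indicator (fun _ => ε⁻¹) x := by
      intro x
      by_cases hxT : x ∈ T
      · rw [indicator_of_mem hxT]
        calc ‖fderiv ℝ η x (φ x)‖ ≤ ‖fderiv ℝ η x‖ * ‖φ x‖ := ContinuousLinearMap.le_opNorm _ _
          _ ≤ ε⁻¹ * 1 := by
            gcongr
            · exact (norm_fderiv_le_of_lipschitz ℝ hηlip).trans_eq
                (Real.coe_toNNReal _ (inv_nonneg.2 hε.le))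
            · exact hb x
          _ = ε⁻¹ := mul_one _
      · rw [indicator_of_notMem hxT]
        have : fderiv ℝ η x = 0 := by
          by_cases hxA : x ∈ A
          · exact IsLocalMax.fderiv_eq_zero (Eventually.of_forall fun y => by
              rw [hηA x hxA]; exact hη1 y)
          · exact IsLocalMin.fderiv_eq_zero (Eventually.of_forall fun y => by
              rw [hηout x fun h => hxT ⟨h, hxA⟩]; exact hη0 y)
        simp [this]
    have hdi := integrable_divergence hφ hc
    have h1 : ∫ x, divergence φ x * η x ≤ f ε := by
      rw [integral_divergence_mul hφ hc hηlip]
      refine (neg_le_abs _).trans ?_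
      rw [← Real.norm_eq_abs]
      refine (norm_integral_le_of_norm_le ((integrable_indicator_iff hT).2
        (integrableOn_const hTfin)) (Eventually.of_forall hfd)).trans ?_
      rw [integral_indicator_const _ hT, smul_eq_mul, ← div_eq_mul_inv, div_le_iff₀ hε]
      linarith
    have h2 : ∫ x in A, divergence φ x - divergence φ x * η x = 0 := by
      refine setIntegral_eq_zero_of_forall_eq_zero fun x hx => ?_
      simp [hηA x hx]
    have hprod : Integrable fun x => divergence φ x * η x :=
      hdi.mul_bdd (c := 1) hηlip.continuous.aestronglyMeasurable (Eventually.of_forall fun x => by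
        rw [Real.norm_eq_abs, abs_of_nonneg (hη0 x)]; exact hη1 x)
    have h3 : ∫ x in A, divergence φ x = ∫ x, A.indicator (divergence φ) x :=
      (integral_indicator hA).symm
    have h4 : ∫ x, (A.indicator (divergence φ) x - divergence φ x * η x) ≤ B * (ε * f ε) := by
      refine (le_abs_self _).trans ?_
      rw [← Real.norm_eq_abs]
      refine (norm_integral_le_of_norm_le (g := T.indicator fun _ => B)
        ((integrable_indicator_iff hT).2
        (integrableOn_const hTfin)) (Eventually.of_forall fun x => ?_)).trans ?_
      · by_cases hxA : x ∈ A
        · simp [hxA, hηA x hxA, T]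
        · by_cases hxT : x ∈ thickening ε A
          · have : x ∈ T := ⟨hxT, hxA⟩
            simp only [hxA, not_false_eq_true, indicator_of_notMem, zero_sub, norm_neg, this,
              indicator_of_mem, norm_mul]
            calc ‖divergence φ x‖ * ‖η x‖ ≤ B * 1 := by
                  gcongr
                  · exact hB x
                  · rw [Real.norm_eq_abs, abs_of_nonneg (hη0 x)]; exact hη1 x
              _ = B := mul_one B
          · have : x ∉ T := fun h => hxT h.1
            simp [hxA, hηout x hxT, this]
      · rw [integral_indicator_const _ hT, smul_eq_mul, mul_comm]
        gcongr
    rw [integral_sub (hdi.indicator hA) hprod] at h4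
    linarith
  have hlim : Tendsto (fun ε => f ε + B * (ε * f ε)) (𝓝[>] 0) (𝓝 (M + B * (0 * M))) := by
    have hid : Tendsto (fun ε : ℝ => ε) (𝓝[>] 0) (𝓝 0) := nhdsWithin_le_nhds
    exact hf.add ((hid.mul hf).const_mul B)
  simp only [zero_mul, mul_zero, add_zero] at hlim
  exact ge_of_tendsto hlim (eventually_mem_nhdsWithin.mono fun ε hε => main ε hε)


/-! ### Perimeter from below: linear test fields -/

/-- A smooth compactly supported cutoff, equal to `1` near a bounded set on which `g ≤ m`, and
supported where `g < M`. -/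
lemma exists_cutoff {n : ℕ} {A : Set (E n)} (hA : Bornology.IsBounded A) {g : E n → ℝ}
    (hg : Continuous g) {m M : ℝ} (hm : ∀ x ∈ A, g x ≤ m) (hM : m < M) :
    ∃ f : E n → ℝ, ContDiff ℝ 1 f ∧ HasCompactSupport f ∧ (∀ x ∈ A, ∀ᶠ y in 𝓝 x, f y = 1) ∧
      (∀ x, f x ∈ Icc (0 : ℝ) 1) ∧ ∀ x, f x ≠ 0 → g x < M := by
  obtain ⟨r, hr⟩ := hA.subset_ball (0 : E n)
  set s : Set (E n) := closure A
  set U : Set (E n) := {x | g x < M} ∩ ball 0 (r + 1)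
  have hU : IsOpen U := (isOpen_lt hg continuous_const).inter isOpen_ball
  have hsU : s ⊆ U := by
    intro x hx
    have hxm : g x ≤ m := closure_minimal hm (isClosed_le hg continuous_const) hx
    refine ⟨hxm.trans_lt hM, ?_⟩
    have := closure_ball_subset_closedBall (closure_mono hr hx)
    rw [mem_closedBall] at this
    rw [mem_ball]; linarith
  obtain ⟨f, hf0, hf1, hf⟩ := exists_contMDiffMap_zero_one_nhds_of_isClosed (n := 1)
    (modelWithCornersSelf ℝ (E n)) (s := Uᶜ) (t := s) hU.isClosed_compl isClosed_closure
    (disjoint_compl_left_iff_subset.2 hsU)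
  have hnz : ∀ x, f x ≠ 0 → x ∈ U := fun x hx => by
    by_contra h
    exact hx (hf0.self_of_nhdsSet x h)
  refine ⟨f, f.contMDiff.contDiff, ?_, fun x hx => ?_, hf, fun x hx => (hnz x hx).1⟩
  · refine HasCompactSupport.of_support_subset_isCompact (isCompact_closedBall (0 : E n) (r + 1)) ?_
    exact fun x hx => ball_subset_closedBall (hnz x hx).2
  · exact (mem_nhdsSet_iff_forall.1 hf1) x (subset_closure hx)

/-- Testing the perimeter with a cutoff of a linear vector field. -/
theorem le_perimeter_of_linear {n : ℕ} {A : Set (E n)} (hA : MeasurableSet A)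
    (hb : Bornology.IsBounded A) (T : E n →L[ℝ] E n) {m τ : ℝ} (hm0 : 0 < m)
    (hT : ∀ x ∈ A, ‖T x‖ ≤ m)
    (hτ : ∑ i, T (EuclideanSpace.single i 1) i = τ) :
    ENNReal.ofReal (τ / m) * volume A ≤ perimeter A := by
  have hfin : volume A ≠ ∞ := hb.measure_lt_top.ne
  -- Dividing by M > m leaves room for the cutoff: |T x| < M still holds on a neighbourhood of the
  -- closure of A. The bound for m follows by letting M decrease to m.
  have main : ∀ M > m, ENNReal.ofReal (τ / M * volume.real A) ≤ perimeter A := by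
    intro M hM
    have hM0 : 0 < M := hm0.trans hM
    obtain ⟨f, hfd, hfc, hf1, hf01, hfM⟩ := exists_cutoff hb (g := fun x => ‖T x‖)
      T.continuous.norm hT hM
    set φ : E n → E n := fun x => f x • (M⁻¹ • T x)
    have hφ : ContDiff ℝ 1 φ := hfd.smul (T.contDiff.const_smul _)
    have hc : HasCompactSupport φ := hfc.smul_right
    have hφ1 : ∀ x, ‖φ x‖ ≤ 1 := by
      intro x
      by_cases hx : f x = 0
      · simp [φ, hx]
      · simp only [φ, norm_smul, norm_inv, Real.norm_eq_abs, abs_of_pos hM0,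
          abs_of_nonneg (hf01 x).1]
        have h := hfM x hx
        calc f x * (M⁻¹ * ‖T x‖) ≤ 1 * (M⁻¹ * M) := by
              gcongr
              exact (hf01 x).2
          _ = 1 := by field_simp
    refine le_trans ?_ (le_iSup_of_le φ <| le_iSup_of_le hφ <| le_iSup_of_le hc <|
      le_iSup_of_le hφ1 le_rfl)
    apply ENNReal.ofReal_le_ofReal
    have hdiv : ∀ x ∈ A, divergence φ x = τ / M := by
      intro x hx
      have he : φ =ᶠ[𝓝 x] fun y => (M⁻¹ • T) y := by
        filter_upwards [hf1 x hx] with y hy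
        simp [φ, hy]
      unfold divergence
      rw [he.fderiv_eq, ContinuousLinearMap.fderiv, ← hτ, Finset.sum_div]
      refine Finset.sum_congr rfl fun i _ => ?_
      simp [div_eq_inv_mul]
    rw [setIntegral_congr_fun hA hdiv, setIntegral_const, smul_eq_mul, mul_comm]
  have hlim : Tendsto (fun M => ENNReal.ofReal (τ / M * volume.real A)) (𝓝[>] m)
      (𝓝 (ENNReal.ofReal (τ / m * volume.real A))) := by
    refine ENNReal.tendsto_ofReal (Tendsto.mul_const _ (Tendsto.div tendsto_const_nhds ?_ hm0.ne'))
    exact nhdsWithin_le_nhds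
  have h := le_of_tendsto hlim (eventually_mem_nhdsWithin.mono fun M hM => main M hM)
  refine le_trans (le_of_eq ?_) h
  rw [ENNReal.ofReal_mul' measureReal_nonneg, ofReal_measureReal hfin]

/-- The perimeter-to-volume ratio of balls is at least `n / R`. -/
theorem le_perimeter_ball {n : ℕ} {R : ℝ} (hR : 0 < R) :
    ENNReal.ofReal (n / R) * volume (ball (0 : E n) R) ≤ perimeter (ball (0 : E n) R) :=
  le_perimeter_of_linear measurableSet_ball isBounded_ball (ContinuousLinearMap.id ℝ (E n)) hR
    (fun x hx => by simpa using (mem_ball_zero_iff.1 hx).le) (by simp)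


/-! ### Cylinders as products and their perimeter -/

/-- Splitting off the last coordinate of `ℝⁿ⁺¹`. -/
def splitLast (n : ℕ) : E (n + 1) ≃ᵐ ℝ × E n :=
  ((MeasurableEquiv.toLp 2 (Fin (n + 1) → ℝ)).symm.trans
    (MeasurableEquiv.piFinSuccAbove (fun _ => ℝ) (Fin.last n))).trans
    ((MeasurableEquiv.refl ℝ).prodCongr (MeasurableEquiv.toLp 2 (Fin n → ℝ)))

lemma measurePreserving_splitLast (n : ℕ) : MeasurePreserving (splitLast n) := by
  have h1 : MeasurePreserving (Prod.map id (WithLp.toLp 2) : ℝ × (Fin n → ℝ) → ℝ × E n) :=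
    (MeasurePreserving.id volume).prod (PiLp.volume_preserving_toLp (Fin n))
  exact h1.comp ((volume_preserving_piFinSuccAbove (fun _ : Fin (n + 1) => ℝ) (Fin.last n)).comp
    (PiLp.volume_preserving_ofLp (Fin (n + 1))))

@[simp] lemma splitLast_fst {n : ℕ} (x : E (n + 1)) : (splitLast n x).1 = x (Fin.last n) := rfl

@[simp] lemma splitLast_snd {n : ℕ} (x : E (n + 1)) (i : Fin n) :
    (splitLast n x).2 i = x i.castSucc := by
  change x ((Fin.last n).succAbove i) = x i.castSucc
  rw [Fin.succAbove_last]

lemma splitLast_sub {n : ℕ} (x y : E (n + 1)) :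
    splitLast n (x - y) = splitLast n x - splitLast n y := by
  refine Prod.ext rfl ?_
  ext i
  simp

lemma norm_sq_splitLast {n : ℕ} (x : E (n + 1)) :
    ‖x‖ ^ 2 = (splitLast n x).1 ^ 2 + ‖(splitLast n x).2‖ ^ 2 := by
  simp [EuclideanSpace.norm_sq_eq, Fin.sum_univ_castSucc, add_comm]

lemma norm_snd_splitLast_le {n : ℕ} (x : E (n + 1)) : ‖(splitLast n x).2‖ ≤ ‖x‖ :=
  le_of_sq_le_sq (by rw [norm_sq_splitLast x]; nlinarith [sq_nonneg (splitLast n x).1]) (norm_nonneg x)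

lemma volume_preimage_splitLast {n : ℕ} {s : Set ℝ} {t : Set (E n)} (hs : MeasurableSet s)
    (ht : MeasurableSet t) :
    volume (splitLast n ⁻¹' (s ×ˢ t)) = volume s * volume t := by
  rw [(measurePreserving_splitLast n).measure_preimage (hs.prod ht).nullMeasurableSet,
    Measure.volume_eq_prod, Measure.prod_prod]

lemma cylinder_eq (l L : ℝ) : cylinder l L = splitLast 2 ⁻¹' (Ioo 0 L ×ˢ ball 0 l) := by
  ext x
  have h : ‖(splitLast 2 x).2‖ = √(x 0 ^ 2 + x 1 ^ 2) := by
    rw [EuclideanSpace.norm_eq]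
    simp [Fin.sum_univ_two]
  simp only [cylinder, mem_ofPred_eq, mem_preimage, mem_prod, mem_ball_zero_iff, h, splitLast_fst]
  exact and_comm

lemma measurableSet_cylinder (l L : ℝ) : MeasurableSet (cylinder l L) := by
  rw [cylinder_eq]
  exact (splitLast 2).measurable (measurableSet_Ioo.prod measurableSet_ball)

lemma volume_cylinder {l L : ℝ} (hl : 0 ≤ l) (hL : 0 ≤ L) :
    volume (cylinder l L) = ENNReal.ofReal (Real.pi * l ^ 2 * L) := by
  rw [cylinder_eq, volume_preimage_splitLast measurableSet_Ioo measurableSet_ball, Real.volume_Ioo,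
    EuclideanSpace.volume_ball_fin_two, sub_zero, ← ENNReal.ofReal_pow hl,
    ← ENNReal.ofReal_mul (by positivity), ← ENNReal.ofReal_mul hL]
  congr 1
  ring

lemma isBounded_cylinder (l L : ℝ) : Bornology.IsBounded (cylinder l L) := by
  refine (isBounded_ball (x := (0 : E 3)) (r := |L| + |l| + 1)).subset fun x hx => ?_
  rw [cylinder_eq] at hx
  obtain ⟨h1, h2⟩ := hx
  rw [mem_ball_zero_iff] at h2 ⊢
  have h := norm_sq_splitLast x
  refine lt_of_pow_lt_pow_left₀ 2 (by positivity) ?_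
  rw [h]
  have hL := le_abs_self L
  have hl := le_abs_self l
  have := norm_nonneg (splitLast 2 x).2
  have := abs_nonneg L
  have := abs_nonneg l
  nlinarith [h1.1, h1.2]

lemma cylinder_nonempty {l L : ℝ} (hl : 0 < l) (hL : 0 < L) : (cylinder l L).Nonempty := by
  refine ⟨(splitLast 2).symm (L / 2, 0), ?_⟩
  rw [cylinder_eq, mem_preimage, MeasurableEquiv.apply_symm_apply]
  exact ⟨⟨by positivity, by linarith⟩, mem_ball_self hl⟩

lemma thickening_cylinder_subset (l L ε : ℝ) :
    thickening ε (cylinder l L) ⊆ splitLast 2 ⁻¹' (Ioo (-ε) (L + ε) ×ˢ ball 0 (l + ε)) := by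
  intro x hx
  obtain ⟨y, hy, hxy⟩ := mem_thickening_iff.1 hx
  rw [cylinder_eq] at hy
  obtain ⟨h1, h2⟩ := hy
  have hd := norm_sq_splitLast (x - y)
  rw [dist_eq_norm] at hxy
  have h3 := norm_snd_splitLast_le (x - y)
  have h4 : |(splitLast 2 (x - y)).1| ≤ ‖x - y‖ :=
    abs_le_of_sq_le_sq (by nlinarith [sq_nonneg ‖(splitLast 2 (x - y)).2‖]) (norm_nonneg _)
  rw [splitLast_sub] at h3 h4
  rw [mem_ball_zero_iff] at h2
  have h5 := abs_le.1 h4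
  refine ⟨⟨?_, ?_⟩, ?_⟩
  · have := h1.1; simp only [Prod.fst_sub] at h5; linarith [h5.1]
  · have := h1.2; simp only [Prod.fst_sub] at h5; linarith [h5.2]
  · rw [mem_ball_zero_iff]
    have h6 := norm_le_norm_add_norm_sub' (splitLast 2 x).2 (splitLast 2 y).2
    simp only [Prod.snd_sub] at h3
    linarith

/-- The ε-thickening lies in a cylinder of radius l + ε and length L + 2ε. The excess volume divided
by ε is the chosen f, whose limit is the lateral area plus the two caps. The absolute values only
keep f nonnegative for negative ε. -/
theorem perimeter_cylinder_le {l L : ℝ} (hl : 0 < l) (hL : 0 < L) :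
    perimeter (cylinder l L) ≤ ENNReal.ofReal (2 * Real.pi * l * L + 2 * Real.pi * l ^ 2) := by
  refine perimeter_le_of_volume_thickening_le (measurableSet_cylinder l L) (cylinder_nonempty hl hL)
    (f := fun ε => Real.pi * (2 * l * L + |ε| * L + 2 * (l + |ε|) ^ 2)) ?_
    (fun ε => by positivity) fun ε hε => ?_
  · have h : Continuous fun ε : ℝ => Real.pi * (2 * l * L + |ε| * L + 2 * (l + |ε|) ^ 2) := by
      fun_prop
    have h0 := h.tendsto 0
    simp only [abs_zero, zero_mul, add_zero] at h0
    convert h0.mono_left nhdsWithin_le_nhds using 2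
    ring
  · have hsub : cylinder l L ⊆ thickening ε (cylinder l L) := self_subset_thickening hε _
    rw [measure_sdiff hsub (measurableSet_cylinder l L).nullMeasurableSet
      (isBounded_cylinder l L).measure_lt_top.ne, volume_cylinder hl.le hL.le, abs_of_pos hε,
      tsub_le_iff_right, ← ENNReal.ofReal_add (by positivity) (by positivity)]
    refine (measure_mono (thickening_cylinder_subset l L ε)).trans (le_of_eq ?_)
    rw [volume_preimage_splitLast measurableSet_Ioo measurableSet_ball, Real.volume_Ioo,
      EuclideanSpace.volume_ball_fin_two, ← ENNReal.ofReal_pow (by positivity),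
      ← ENNReal.ofReal_mul (by positivity), sub_neg_eq_add, ← ENNReal.ofReal_mul (by positivity)]
    congr 1
    ring

/-- The orthogonal projection of `ℝ³` to the first two coordinates. -/
def horizontalProj : E 3 →L[ℝ] E 3 :=
  ContinuousLinearMap.id ℝ (E 3) -
    (EuclideanSpace.proj 2 : E 3 →L[ℝ] ℝ).smulRight (EuclideanSpace.single 2 1)

/-- The horizontal field has trace 2 and norm below l on the cylinder; it sees the lateral surface
and ignores the caps. -/
theorem le_perimeter_cylinder {l : ℝ} (hl : 0 < l) (L : ℝ) :
    ENNReal.ofReal (2 / l) * volume (cylinder l L) ≤ perimeter (cylinder l L) := by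
  refine le_perimeter_of_linear (measurableSet_cylinder l L) (isBounded_cylinder l L)
    horizontalProj hl (fun x hx => ?_) ?_
  · rw [EuclideanSpace.norm_eq]
    refine le_of_eq_of_le ?_ hx.1.le
    simp [Fin.sum_univ_three, horizontalProj]
  · simp [Fin.sum_univ_three, horizontalProj]
    norm_num

theorem tendsto_perimeter_cylinder_div {l : ℝ} (hl : 0 < l) :
    Tendsto (fun L : ℝ => perimeter (cylinder l L) / volume (cylinder l L)) atTop
      (𝓝 (ENNReal.ofReal (2 / l))) := by
  have hub : Tendsto (fun L : ℝ => ENNReal.ofReal (2 / l + 2 / L)) atTop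
      (𝓝 (ENNReal.ofReal (2 / l + 0))) :=
    ENNReal.tendsto_ofReal (tendsto_const_nhds.add (tendsto_const_nhds.div_atTop tendsto_id))
  rw [add_zero] at hub
  refine tendsto_of_tendsto_of_tendsto_of_le_of_le' tendsto_const_nhds hub ?_ ?_
  · filter_upwards [eventually_gt_atTop 0] with L hL
    have hV : 0 < Real.pi * l ^ 2 * L := by positivity
    rw [ENNReal.le_div_iff_mul_le (Or.inl ?_) (Or.inl ?_)]
    · exact le_perimeter_cylinder hl L
    · rw [volume_cylinder hl.le hL.le]; simpa using hV
    · exact (isBounded_cylinder l L).measure_lt_top.ne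
  · filter_upwards [eventually_gt_atTop 0] with L hL
    have hV : 0 < Real.pi * l ^ 2 * L := by positivity
    refine ENNReal.div_le_of_le_mul ((perimeter_cylinder_le hl hL).trans (le_of_eq ?_))
    rw [volume_cylinder hl.le hL.le, ← ENNReal.ofReal_mul (by positivity)]
    congr 1
    field_simp

/-! ### Interaction through overlaps and the limit of long cylinders -/

lemma measurableSet_overlap {n : ℕ} {A : Set (E n)} (hA : MeasurableSet A) (z : E n) :
    MeasurableSet {x | x ∈ A ∧ x - z ∈ A} := by
  have hs : Measurable fun x : E n => x - z := measurable_id.sub_const z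
  exact hA.inter (hs hA)

/-- The interaction as an integral over the displacement, weighted by overlaps. -/
theorem interaction_eq_lintegral_overlap {n : ℕ} {G : E n → ℝ} (hG : Measurable G) {A : Set (E n)}
    (hA : MeasurableSet A) :
    interaction G A = ∫⁻ z, ENNReal.ofReal (G z) * volume {x | x ∈ A ∧ x - z ∈ A} := by
  have hg : Measurable fun z => ENNReal.ofReal (G z) := hG.ennreal_ofReal
  have hS : MeasurableSet {p : E n × E n | p.1 ∈ A ∧ p.1 - p.2 ∈ A} :=
    (measurable_fst hA).inter ((measurable_fst.sub measurable_snd) hA)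
  calc interaction G A
      = ∫⁻ x, ∫⁻ z, {p : E n × E n | p.1 ∈ A ∧ p.1 - p.2 ∈ A}.indicator
          (fun p => ENNReal.ofReal (G p.2)) (x, z) := by
        unfold interaction
        rw [← lintegral_indicator hA]
        refine lintegral_congr fun x => ?_
        by_cases hx : x ∈ A
        · rw [indicator_of_mem hx, ← lintegral_indicator hA, ← lintegral_sub_left_eq_self _ x]
          refine lintegral_congr fun z => ?_
          by_cases hz : x - z ∈ A <;> simp [indicator, hx, hz]
        · rw [indicator_of_notMem hx]
          simp [hx]
    _ = ∫⁻ z, ∫⁻ x, {p : E n × E n | p.1 ∈ A ∧ p.1 - p.2 ∈ A}.indicator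
          (fun p => ENNReal.ofReal (G p.2)) (x, z) := by
        refine lintegral_lintegral_swap ?_
        exact ((hg.comp measurable_snd).indicator hS).aemeasurable
    _ = _ := by
        refine lintegral_congr fun z => ?_
        rw [← lintegral_indicator_const (measurableSet_overlap hA z)]
        rfl

lemma overlap_cylinder (l L : ℝ) (z : E 3) :
    volume {x | x ∈ cylinder l L ∧ x - z ∈ cylinder l L} = ENNReal.ofReal (L - |z 2|) *
      volume {x : E 2 | x ∈ ball 0 l ∧ x - (splitLast 2 z).2 ∈ ball 0 l} := by
  have h : {x | x ∈ cylinder l L ∧ x - z ∈ cylinder l L} = splitLast 2 ⁻¹'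
      (Ioo (max 0 (z 2)) (min L (L + z 2)) ×ˢ
        {x : E 2 | x ∈ ball 0 l ∧ x - (splitLast 2 z).2 ∈ ball 0 l}) := by
    ext x
    have e : (splitLast 2 z).1 = z 2 := rfl
    simp only [cylinder_eq, mem_ofPred_eq, mem_preimage, splitLast_sub, mem_prod, Prod.fst_sub,
      Prod.snd_sub, mem_Ioo, max_lt_iff, lt_min_iff, e]
    constructor
    · rintro ⟨⟨⟨h1, h2⟩, h3⟩, ⟨h4, h5⟩, h6⟩
      exact ⟨⟨⟨h1, by linarith⟩, h2, by linarith⟩, h3, h6⟩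
    · rintro ⟨⟨⟨h1, h4⟩, h2, h5⟩, h3, h6⟩
      exact ⟨⟨⟨h1, h2⟩, h3⟩, ⟨by linarith, by linarith⟩, h6⟩
  rw [h, volume_preimage_splitLast measurableSet_Ioo (measurableSet_overlap measurableSet_ball _),
    Real.volume_Ioo]
  congr 2
  rcases le_total 0 (z 2) with h0 | h0
  · rw [max_eq_right h0, min_eq_left (by linarith), abs_of_nonneg h0]
  · rw [max_eq_left h0, min_eq_right (by linarith), abs_of_nonpos h0]; ring

/-- The interaction per unit of mass of an infinite cylinder. -/
def cylinderInteraction (G : E 3 → ℝ) (l : ℝ) : ℝ≥0∞ :=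
  ∫⁻ z, ENNReal.ofReal (G z) * (volume {x : E 2 | x ∈ ball 0 l ∧ x - (splitLast 2 z).2 ∈ ball 0 l} *
    (ENNReal.ofReal (Real.pi * l ^ 2))⁻¹)

lemma interaction_cylinder_div {G : E 3 → ℝ} (hG : Measurable G) {l L : ℝ} (hl : 0 < l)
    (hL : 0 < L) :
    interaction G (cylinder l L) / volume (cylinder l L) =
      ∫⁻ z, ENNReal.ofReal (1 - |z 2| / L) * (ENNReal.ofReal (G z) *
        (volume {x : E 2 | x ∈ ball 0 l ∧ x - (splitLast 2 z).2 ∈ ball 0 l} *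
          (ENNReal.ofReal (Real.pi * l ^ 2))⁻¹)) := by
  have hV : 0 < Real.pi * l ^ 2 * L := by positivity
  rw [interaction_eq_lintegral_overlap hG (measurableSet_cylinder l L), volume_cylinder hl.le hL.le,
    div_eq_mul_inv, ← lintegral_mul_const' _ _ (ENNReal.inv_ne_top.2 (by simpa using hV))]
  refine lintegral_congr fun z => ?_
  have h1 : ENNReal.ofReal (L - |z 2|) = ENNReal.ofReal (1 - |z 2| / L) * ENNReal.ofReal L := by
    rw [← ENNReal.ofReal_mul' hL.le]
    congr 1
    field_simp
  have h2 : (ENNReal.ofReal (Real.pi * l ^ 2 * L))⁻¹ =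
      (ENNReal.ofReal (Real.pi * l ^ 2))⁻¹ * (ENNReal.ofReal L)⁻¹ := by
    rw [ENNReal.ofReal_mul (by positivity), ENNReal.mul_inv (Or.inr ENNReal.ofReal_ne_top)
      (Or.inl ENNReal.ofReal_ne_top)]
  have h3 : ENNReal.ofReal L * (ENNReal.ofReal L)⁻¹ = 1 :=
    ENNReal.mul_inv_cancel (by simpa using hL) ENNReal.ofReal_ne_top
  rw [overlap_cylinder, h1, h2]
  set a := ENNReal.ofReal (1 - |z 2| / L)
  set b := ENNReal.ofReal L
  set c := volume {x : E 2 | x ∈ ball 0 l ∧ x - (splitLast 2 z).2 ∈ ball 0 l}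
  set d := (ENNReal.ofReal (Real.pi * l ^ 2))⁻¹
  calc ENNReal.ofReal (G z) * (a * b * c) * (d * b⁻¹)
      = a * (ENNReal.ofReal (G z) * (c * d)) * (b * b⁻¹) := by ring
    _ = _ := by rw [h3, mul_one]

/-- The energy per unit of mass of long cylinders converges; the limit is bounded by the energy per
unit of mass of the infinite cylinder. -/
theorem tendsto_energyPerMass_cylinder {G : E 3 → ℝ} (hG : Measurable G) {l : ℝ} (hl : 0 < l) :
    ∃ σ, Tendsto (fun L : ℝ => energyPerMass G (cylinder l L)) atTop (𝓝 σ) ∧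
      σ ≤ ENNReal.ofReal (2 / l) + cylinderInteraction G l := by
  -- With `max L 1` in the denominator the weight is monotone in L on the whole line, so I converges
  -- to its supremum in [0, ∞] with no integrability assumption.
  set I : ℝ → ℝ≥0∞ := fun L =>
    ∫⁻ z, ENNReal.ofReal (1 - |z 2| / max L 1) * (ENNReal.ofReal (G z) *
        (volume {x : E 2 | x ∈ ball 0 l ∧ x - (splitLast 2 z).2 ∈ ball 0 l} *
          (ENNReal.ofReal (Real.pi * l ^ 2))⁻¹))
  have hmono : Monotone I := fun L L' h => by
    refine lintegral_mono fun z => ?_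
    gcongr
  have hle : ∀ L, I L ≤ cylinderInteraction G l := fun L => by
    refine lintegral_mono fun z => ?_
    refine (mul_le_mul_left (ENNReal.ofReal_le_one.2 ?_) _).trans_eq (one_mul _)
    have : 0 ≤ |z 2| / max L 1 := by positivity
    linarith
  have hlim := tendsto_atTop_iSup hmono
  refine ⟨ENNReal.ofReal (2 / l) + ⨆ L, I L, ?_, by gcongr; exact iSup_le hle⟩
  refine ((tendsto_perimeter_cylinder_div hl).add hlim).congr' ?_
  filter_upwards [eventually_ge_atTop 1] with L hL
  rw [energyPerMass, energy, ENNReal.add_div, interaction_cylinder_div hG hl (by linarith)]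
  simp only [I, max_eq_left hL]

theorem tendsto_sigmaCyl {G : E 3 → ℝ} (hG : Measurable G) {l : ℝ} (hl : 0 < l) :
    Tendsto (fun L : ℝ => energyPerMass G (cylinder l L)) atTop (𝓝 (sigmaCyl G l)) :=
  tendsto_nhds_limUnder ((tendsto_energyPerMass_cylinder hG hl).imp fun _ h => h.1)

theorem rhoCyl_le {G : E 3 → ℝ} (hG : Measurable G) {l : ℝ} (hl : 0 < l) :
    rhoCyl G ≤ ENNReal.ofReal (2 / l) + cylinderInteraction G l := by
  obtain ⟨σ, hσ, hle⟩ := tendsto_energyPerMass_cylinder hG hl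
  refine (iInf₂_le l hl).trans ?_
  rwa [tendsto_nhds_unique (tendsto_sigmaCyl hG hl) hσ]


/-! ### The overlap of two balls -/

/-- The reflection exchanging z and w preserves both volume and centred balls. It serves to rotate
the displacement onto the last axis. -/
lemma volume_overlap_ball_congr {n : ℕ} (R : ℝ) {z w : E n} (h : ‖z‖ = ‖w‖) :
    volume {x | x ∈ ball (0 : E n) R ∧ x - z ∈ ball 0 R} =
      volume {x | x ∈ ball (0 : E n) R ∧ x - w ∈ ball 0 R} := by
  set ρ := (ℝ ∙ (z - w))ᗮ.reflection
  have hρ : ρ z = w := Submodule.reflection_sub h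
  rw [← ρ.measurePreserving.measure_preimage
    (measurableSet_overlap measurableSet_ball w).nullMeasurableSet]
  congr 1
  ext x
  simp only [mem_ofPred_eq, mem_preimage, mem_ball_zero_iff, LinearIsometryEquiv.norm_map]
  rw [← hρ, ← map_sub, LinearIsometryEquiv.norm_map]

/-- Two overlapping balls of equal radius meet in two congruent caps. -/
theorem volume_overlap_ball {n : ℕ} [Nontrivial (E n)] {R : ℝ} (hR : 0 ≤ R) (z : E (n + 1)) :
    volume {x | x ∈ ball (0 : E (n + 1)) R ∧ x - z ∈ ball 0 R} =
      2 * ∫⁻ t in Ioi (‖z‖ / 2), ENNReal.ofReal (√(R ^ 2 - t ^ 2) ^ n) *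
        volume (ball (0 : E n) 1) := by
  set s := ‖z‖
  have hs : 0 ≤ s := norm_nonneg z
  set F : ℝ → ℝ≥0∞ := fun t => ENNReal.ofReal (√(R ^ 2 - t ^ 2) ^ n) * volume (ball (0 : E n) 1)
  have hFm : Measurable F := by
    refine Measurable.mul_const (Measurable.ennreal_ofReal ?_) _
    fun_prop
  have hF : ∀ t, volume (ball (0 : E n) √(R ^ 2 - t ^ 2)) = F t := fun t => by
    rw [Measure.addHaar_ball _ _ (Real.sqrt_nonneg _), finrank_euclideanSpace_fin]
  set w : E (n + 1) := EuclideanSpace.single (Fin.last n) s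
  have hw : ‖z‖ = ‖w‖ := by simp [w, s]
  have hw1 : (splitLast n w).1 = s := by simp [w]
  have hw2 : (splitLast n w).2 = 0 := by ext i; simp [w, Fin.castSucc_ne_last]
  have hball : ∀ x : E (n + 1), x ∈ ball (0 : E (n + 1)) R ↔
      (splitLast n x).1 ^ 2 + ‖(splitLast n x).2‖ ^ 2 < R ^ 2 := fun x => by
    rw [mem_ball_zero_iff, ← norm_sq_splitLast, sq_lt_sq₀ (norm_nonneg _) hR]
  set S : Set (ℝ × E n) := {p | p.1 ^ 2 + ‖p.2‖ ^ 2 < R ^ 2 ∧ (p.1 - s) ^ 2 + ‖p.2‖ ^ 2 < R ^ 2}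
  have hS : MeasurableSet S :=
    (measurableSet_lt (f := fun p : ℝ × E n => p.1 ^ 2 + ‖p.2‖ ^ 2) (g := fun _ => R ^ 2)
      (by fun_prop) (by fun_prop)).inter
      (measurableSet_lt (f := fun p : ℝ × E n => (p.1 - s) ^ 2 + ‖p.2‖ ^ 2) (g := fun _ => R ^ 2)
      (by fun_prop) (by fun_prop))
  have hpre : {x | x ∈ ball (0 : E (n + 1)) R ∧ x - w ∈ ball 0 R} = splitLast n ⁻¹' S := by
    ext x
    simp only [mem_ofPred_eq, hball, splitLast_sub, Prod.fst_sub, Prod.snd_sub, hw1, hw2, sub_zero,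
      mem_preimage, S]
  -- Beyond the midpoint s/2 the ball around 0 is the binding constraint, before it the ball around
  -- w; t ↦ s - t exchanges the two caps. Since `√` is 0 on negative numbers, slices out of reach
  -- are empty balls.
  have hslice : ∀ t, volume (Prod.mk t ⁻¹' S) =
      (Ioi (s / 2)).indicator F t + (Ici (s / 2)).indicator F (s - t) := by
    intro t
    rcases lt_or_ge (s / 2) t with ht | ht
    · rw [indicator_of_mem (show t ∈ Ioi (s / 2) from ht),
        indicator_of_notMem (show s - t ∉ Ici (s / 2) from fun h => by
          rw [mem_Ici] at h; linarith), add_zero, ← hF]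
      congr 1
      ext y
      simp only [mem_preimage, mem_ofPred_eq, mem_ball_zero_iff, Real.lt_sqrt (norm_nonneg y), S]
      constructor
      · rintro ⟨h, _⟩; linarith
      · intro h
        refine ⟨by linarith, ?_⟩
        nlinarith
    · rw [indicator_of_notMem (show t ∉ Ioi (s / 2) from not_lt.2 ht),
        indicator_of_mem (show s - t ∈ Ici (s / 2) by rw [mem_Ici]; linarith), zero_add, ← hF]
      congr 1
      ext y
      simp only [mem_preimage, mem_ofPred_eq, mem_ball_zero_iff, Real.lt_sqrt (norm_nonneg y), S]
      constructor
      · rintro ⟨_, h⟩; nlinarith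
      · intro h
        refine ⟨?_, by nlinarith⟩
        nlinarith
  rw [volume_overlap_ball_congr R hw, hpre,
    (measurePreserving_splitLast n).measure_preimage hS.nullMeasurableSet, Measure.volume_eq_prod,
    Measure.prod_apply hS, lintegral_congr hslice,
    lintegral_add_left (hFm.indicator measurableSet_Ioi),
    lintegral_sub_left_eq_self (fun t => (Ici (s / 2)).indicator F t) s,
    lintegral_indicator measurableSet_Ioi, lintegral_indicator measurableSet_Ici,
    setLIntegral_congr Ioi_ae_eq_Ici, two_mul]

/-! ### The overlap of two discs -/

/-- A polynomial minorant of `∫₀ᵗ √(1 - v²) dv`. -/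
def discMinorant (t : ℝ) : ℝ := t - t ^ 3 / 6 - t ^ 5 / 40 - t ^ 7 / 32

/-- The derivative of `discMinorant`. -/
def discMinorantDeriv (v : ℝ) : ℝ := 1 - v ^ 2 / 2 - v ^ 4 / 8 - 7 * v ^ 6 / 32

lemma integral_discMinorantDeriv (a b : ℝ) :
    ∫ v in a..b, discMinorantDeriv v = discMinorant b - discMinorant a := by
  refine intervalIntegral.integral_eq_sub_of_hasDerivAt (fun v _ => ?_) ?_
  · unfold discMinorant discMinorantDeriv
    refine HasDerivAt.congr_deriv (((((hasDerivAt_id' v).sub ((hasDerivAt_pow 3 v).div_const 6)).sub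
      ((hasDerivAt_pow 5 v).div_const 40)).sub ((hasDerivAt_pow 7 v).div_const 32))) ?_
    ring
  · refine Continuous.intervalIntegrable ?_ _ _
    unfold discMinorantDeriv
    fun_prop

lemma integral_sqrt_one_sub_sq_zero_one : ∫ v in (0 : ℝ)..1, √(1 - v ^ 2) = Real.pi / 4 := by
  have hc : Continuous fun v : ℝ => √(1 - v ^ 2) := by fun_prop
  have h := intervalIntegral.integral_add_adjacent_intervals
    (hc.intervalIntegrable (μ := volume) (-1) 0) (hc.intervalIntegrable 0 1)
  have h' := intervalIntegral.integral_comp_neg (a := 0) (b := 1) fun v : ℝ => √(1 - v ^ 2)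
  simp only [neg_sq, neg_zero] at h'
  rw [integral_sqrt_one_sub_sq, ← h'] at h
  linarith

lemma discMinorant_one_le : discMinorant 1 ≤ Real.pi / 4 := by
  have := Real.pi_gt_d2
  norm_num [discMinorant]
  linarith

/-- At 1 the polynomial still increases, with slope 5/32, so its value there does not suffice and
its maximum slightly to the right has to be controlled. -/
lemma discMinorant_le_of_one_le {t : ℝ} (ht : 1 ≤ t) : discMinorant t ≤ Real.pi / 4 := by
  have := Real.pi_gt_d2
  have h : discMinorant t ≤ 785 / 1000 := by
    obtain ⟨w, hw, rfl⟩ : ∃ w, 0 ≤ w ∧ t = 1 + w := ⟨t - 1, by linarith, by ring⟩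
    unfold discMinorant
    have h3 : 0 ≤ w ^ 3 := by positivity
    have h4 : 0 ≤ w ^ 4 := by positivity
    have h5 : 0 ≤ w ^ 5 := by positivity
    have h6 : 0 ≤ w ^ 6 := by positivity
    have h7 : 0 ≤ w ^ 7 := by positivity
    nlinarith [sq_nonneg (w - 1 / 20)]
  linarith

/-- The area of a circular cap of the unit disc, from above. -/
lemma integral_sqrt_one_sub_sq_le {t : ℝ} (h0 : 0 ≤ t) (h1 : t ≤ 1) :
    ∫ v in t..1, √(1 - v ^ 2) ≤ Real.pi / 4 - discMinorant t := by
  have hc : Continuous fun v : ℝ => √(1 - v ^ 2) := by fun_prop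
  have hd : Continuous discMinorantDeriv := by unfold discMinorantDeriv; fun_prop
  -- Through order 5 `discMinorant` is the Taylor polynomial, so the squares differ by v⁶ g(v) with
  -- g increasing on [0, ∞): the sign changes at most once. Integration over [0, t] works before the
  -- change and over [t, 1] after it. The latter needs `discMinorant 1 ≤ π / 4`, which fails for the
  -- Taylor coefficient 1/112 and holds for 1/32.
  set g : ℝ → ℝ := fun v => (1 / 8 - 7 / 16) + v ^ 2 * (1 / 64 + 7 / 32) + v ^ 4 * (7 / 128) +
    v ^ 6 * (7 / 32) ^ 2
  have hg : ∀ v, discMinorantDeriv v ^ 2 - (1 - v ^ 2) = v ^ 6 * g v := fun v => by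
    simp only [discMinorantDeriv, g]; ring
  have hgm : ∀ u v, 0 ≤ u → u ≤ v → g u ≤ g v := fun u v hu huv => by
    simp only [g]; gcongr
  rcases le_total (g t) 0 with hgt | hgt
  · have hle : ∫ v in (0 : ℝ)..t, discMinorantDeriv v ≤ ∫ v in (0 : ℝ)..t, √(1 - v ^ 2) := by
      refine intervalIntegral.integral_mono_on h0 (hd.intervalIntegrable _ _)
        (hc.intervalIntegrable _ _) fun v hv => ?_
      refine Real.le_sqrt_of_sq_le ?_
      have h := hgm v t hv.1 hv.2
      have h6 : 0 ≤ v ^ 6 := by positivity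
      nlinarith [hg v, mul_nonneg h6 (sub_nonneg.2 (h.trans hgt))]
    have hadd := intervalIntegral.integral_add_adjacent_intervals
      (hc.intervalIntegrable (μ := volume) 0 t) (hc.intervalIntegrable t 1)
    rw [integral_sqrt_one_sub_sq_zero_one] at hadd
    rw [integral_discMinorantDeriv] at hle
    have : discMinorant 0 = 0 := by norm_num [discMinorant]
    linarith
  · have hle : ∫ v in t..1, √(1 - v ^ 2) ≤ ∫ v in t..1, discMinorantDeriv v := by
      refine intervalIntegral.integral_mono_on h1 (hc.intervalIntegrable _ _)
        (hd.intervalIntegrable _ _) fun v hv => ?_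
      have hv0 : 0 ≤ v := h0.trans hv.1
      refine Real.sqrt_le_iff.2 ⟨?_, ?_⟩
      · have h2 : v ^ 2 ≤ 1 := pow_le_one₀ hv0 hv.2
        have h4 : v ^ 4 ≤ 1 := pow_le_one₀ hv0 hv.2
        have h6 : v ^ 6 ≤ 1 := pow_le_one₀ hv0 hv.2
        unfold discMinorantDeriv
        linarith
      · have h := hgm t v h0 hv.1
        have h6 : 0 ≤ v ^ 6 := by positivity
        nlinarith [hg v, mul_nonneg h6 (hgt.trans h)]
    rw [integral_discMinorantDeriv] at hle
    linarith [discMinorant_one_le]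

lemma volume_ball_one_dim : volume (ball (0 : E 1) 1) = 2 := by
  rw [InnerProductSpace.volume_ball_of_dim_odd (k := 0) (by simp)]
  norm_num

/-- Upper bound for the area of the overlap of two discs. -/
theorem volume_overlap_disc_le {l : ℝ} (hl : 0 < l) (z : E 2) :
    volume {x | x ∈ ball (0 : E 2) l ∧ x - z ∈ ball 0 l} ≤
      ENNReal.ofReal (Real.pi * l ^ 2 - 4 * l ^ 2 * discMinorant (‖z‖ / (2 * l))) := by
  rw [volume_overlap_ball hl.le z]
  set s := ‖z‖
  have hs : 0 ≤ s := norm_nonneg z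
  have hst : s / (2 * l) = (s / 2) / l := by field_simp
  simp only [pow_one, volume_ball_one_dim]
  rw [hst]
  -- If s ≥ 2l the discs are disjoint and the cap integral vanishes.
  rcases le_total l (s / 2) with hls | hls
  · rw [setLIntegral_congr_fun (g := fun _ => 0) measurableSet_Ioi fun t ht => ?_]
    · simp
    · have hlt : l ≤ t := hls.trans (le_of_lt ht)
      have : √(l ^ 2 - t ^ 2) = 0 := Real.sqrt_eq_zero_of_nonpos (by nlinarith)
      simp [this]
  · have hc : Continuous fun t : ℝ => √(l ^ 2 - t ^ 2) := by fun_prop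
    have hzero : ∫⁻ t in Ioi l, ENNReal.ofReal √(l ^ 2 - t ^ 2) * 2 = 0 := by
      rw [setLIntegral_congr_fun (g := fun _ => 0) measurableSet_Ioi fun t ht => ?_]
      · simp
      · have hlt : l ≤ t := le_of_lt ht
        have : √(l ^ 2 - t ^ 2) = 0 := Real.sqrt_eq_zero_of_nonpos (by nlinarith)
        simp [this]
    have hscale : ∫ t in (s / 2)..l, √(l ^ 2 - t ^ 2) = l ^ 2 * ∫ v in (s / 2 / l)..1, √(1 - v ^ 2) := by
      have h := intervalIntegral.integral_comp_div (a := s / 2) (b := l)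
        (fun v : ℝ => √(1 - v ^ 2)) hl.ne'
      rw [div_self hl.ne'] at h
      rw [show ∀ X : ℝ, l ^ 2 * X = l * (l • X) from fun X => by rw [smul_eq_mul]; ring, ← h,
        ← intervalIntegral.integral_const_mul]
      refine intervalIntegral.integral_congr fun t _ => ?_
      rw [show l ^ 2 - t ^ 2 = l ^ 2 * (1 - (t / l) ^ 2) by field_simp, Real.sqrt_mul (sq_nonneg l),
        Real.sqrt_sq hl.le]
    rw [← Ioc_union_Ioi_eq_Ioi hls, lintegral_union measurableSet_Ioi
      (Ioc_disjoint_Ioi le_rfl), hzero, add_zero, lintegral_mul_const' _ _ (by simp),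
      ← ofReal_integral_eq_lintegral_ofReal (hc.integrableOn_Ioc)
        (Eventually.of_forall fun t => Real.sqrt_nonneg _),
      ← intervalIntegral.integral_of_le hls, hscale,
      show (2 : ℝ≥0∞) = ENNReal.ofReal 2 by simp, ← ENNReal.ofReal_mul' (by norm_num),
      ← ENNReal.ofReal_mul (by norm_num)]
    apply ENNReal.ofReal_le_ofReal
    have h := integral_sqrt_one_sub_sq_le (t := s / 2 / l) (by positivity)
      (by rw [div_le_one hl]; exact hls)
    nlinarith [mul_le_mul_of_nonneg_left h (sq_nonneg l)]

/-- Lower bound for the volume of the overlap of two balls in `ℝ³`. -/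
theorem le_volume_overlap_ball {R : ℝ} (hR : 0 < R) (z : E 3) (hz : ‖z‖ ≤ 2 * R) :
    ENNReal.ofReal (2 * Real.pi * (2 / 3 * R ^ 3 - R ^ 2 * ‖z‖ / 2 + ‖z‖ ^ 3 / 24)) ≤
      volume {x | x ∈ ball (0 : E 3) R ∧ x - z ∈ ball 0 R} := by
  rw [volume_overlap_ball hR.le z]
  set s := ‖z‖
  have hs : 0 ≤ s := norm_nonneg z
  have hsR : s / 2 ≤ R := by linarith
  have hc : Continuous fun t : ℝ => R ^ 2 - t ^ 2 := by fun_prop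
  have hint : ∫ t in (s / 2)..R, (R ^ 2 - t ^ 2) = 2 / 3 * R ^ 3 - R ^ 2 * s / 2 + s ^ 3 / 24 := by
    rw [intervalIntegral.integral_sub (by simp) (by simp)]
    simp
    ring
  have hb : volume (ball (0 : E 2) 1) = ENNReal.ofReal Real.pi := by
    rw [EuclideanSpace.volume_ball_fin_two]; simp
  calc ENNReal.ofReal (2 * Real.pi * (2 / 3 * R ^ 3 - R ^ 2 * s / 2 + s ^ 3 / 24))
      = 2 * ∫⁻ t in Ioc (s / 2) R, ENNReal.ofReal (R ^ 2 - t ^ 2) * volume (ball (0 : E 2) 1) := by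
        rw [hb, lintegral_mul_const' _ _ (by simp),
          ← ofReal_integral_eq_lintegral_ofReal hc.integrableOn_Ioc,
          ← intervalIntegral.integral_of_le hsR, hint, show (2 : ℝ≥0∞) = ENNReal.ofReal 2 by simp,
          ← ENNReal.ofReal_mul' Real.pi_pos.le, ← ENNReal.ofReal_mul (by norm_num)]
        · congr 1; ring
        · refine (ae_restrict_iff' measurableSet_Ioc).2 (Eventually.of_forall fun t ht => ?_)
          have : 0 ≤ t := by linarith [ht.1]
          have := ht.2
          simp only [Pi.zero_apply]
          nlinarith
    _ ≤ 2 * ∫⁻ t in Ioc (s / 2) R, ENNReal.ofReal (√(R ^ 2 - t ^ 2) ^ 2) *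
          volume (ball (0 : E 2) 1) := by
        gcongr with t
        rcases le_total 0 (R ^ 2 - t ^ 2) with h | h
        · rw [Real.sq_sqrt h]
        · exact h.trans (sq_nonneg _)
    _ ≤ _ := by
        gcongr
        exact Ioc_subset_Ioi_self


/-! ### Moments of radial kernels -/

/-- The integral of a radial function times a homogeneous one. -/
lemma integral_radial_mul_homogeneous {n : ℕ} [Nontrivial (E n)] (k : ℕ) {h : E n → ℝ}
    (hh : ∀ r : ℝ, 0 < r → ∀ x, h (r • x) = r ^ k * h x) (g : ℝ → ℝ) :
    ∫ x, g ‖x‖ * h x = (∫ ω : sphere (0 : E n) 1, h ω ∂(volume : Measure (E n)).toSphere) *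
      ∫ r in Ioi (0 : ℝ), r ^ (n - 1) * (r ^ k * g r) := by
  calc ∫ x, g ‖x‖ * h x
      = ∫ x : ({(0)}ᶜ : Set (E n)), g ‖x.1‖ * h x.1 ∂((volume : Measure (E n)).comap (↑)) := by
        rw [integral_subtype_comap (measurableSet_singleton _).compl fun x : E n => g ‖x‖ * h x,
          restrict_compl_singleton]
    _ = ∫ p : sphere (0 : E n) 1 × Ioi (0 : ℝ), h p.1 * (p.2.1 ^ k * g p.2)
          ∂(volume : Measure (E n)).toSphere.prod
            (Measure.volumeIoiPow (Module.finrank ℝ (E n) - 1)) := by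
        rw [← (volume : Measure (E n)).measurePreserving_homeomorphUnitSphereProd.integral_comp
          (Homeomorph.measurableEmbedding _)]
        refine integral_congr_ae (Eventually.of_forall fun x => ?_)
        have hx : 0 < ‖x.1‖ := norm_pos_iff.2 x.2
        have hxe : x.1 = ‖x.1‖ • (‖x.1‖⁻¹ • x.1) := by
          rw [smul_smul, mul_inv_cancel₀ hx.ne', one_smul]
        simp only [homeomorphUnitSphereProd_apply_snd_coe, homeomorphUnitSphereProd_apply_fst_coe]
        conv_lhs => rw [hxe, hh _ hx, ← hxe]
        ring
    _ = _ := by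
        rw [integral_prod_mul (fun ω : sphere (0 : E n) 1 => h ω)
          (fun r : Ioi (0 : ℝ) => r.1 ^ k * g r)]
        congr 1
        simp only [Measure.volumeIoiPow, ENNReal.ofReal]
        rw [integral_withDensity_eq_integral_smul,
          integral_subtype_comap measurableSet_Ioi
            fun a => Real.toNNReal (a ^ (Module.finrank ℝ (E n) - 1)) • (a ^ k * g a),
          setIntegral_congr_fun measurableSet_Ioi fun x hx => ?_]
        · rw [NNReal.smul_def, Real.coe_toNNReal _ (pow_nonneg hx.out.le _),
            finrank_euclideanSpace_fin, smul_eq_mul]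
        · exact (measurable_subtype_coe.pow_const _).real_toNNReal

lemma integral_pow_mul_exp_neg_sq (k : ℕ) :
    ∫ r in Ioi (0 : ℝ), r ^ k * Real.exp (-r ^ 2) = 1 / 2 * Real.Gamma ((k + 1) / 2) := by
  rw [← integral_rpow_mul_exp_neg_rpow (p := 2) (q := k) (by norm_num)
    (by have : (0 : ℝ) ≤ k := by positivity
        linarith)]
  refine setIntegral_congr_fun measurableSet_Ioi fun r _ => ?_
  simp only [Real.rpow_natCast]
  norm_cast

/-- Moments of a radial function on `ℝ³` with respect to the distance to the third axis. -/
theorem integral_radial_mul_norm_snd_pow (k : ℕ) (g : ℝ → ℝ) :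
    ∫ x : E 3, g ‖x‖ * ‖(splitLast 2 x).2‖ ^ k =
      2 * Real.pi * √Real.pi * (Real.Gamma (k / 2 + 1) / Real.Gamma ((k + 3) / 2)) *
        ∫ r in Ioi (0 : ℝ), r ^ 2 * (r ^ k * g r) := by
  have hh : ∀ r : ℝ, 0 < r → ∀ x : E 3,
      ‖(splitLast 2 (r • x)).2‖ ^ k = r ^ k * ‖(splitLast 2 x).2‖ ^ k := by
    intro r hr x
    have : (splitLast 2 (r • x)).2 = r • (splitLast 2 x).2 := by ext i; simp
    rw [this, norm_smul, mul_pow, Real.norm_eq_abs, abs_of_pos hr]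
  -- The integral over the sphere does not depend on g, so it is read off from the Gaussian, for
  -- which the integral over ℝ × ℝ² factorises.
  have hG := integral_radial_mul_homogeneous (h := fun x : E 3 => ‖(splitLast 2 x).2‖ ^ k) k hh fun r => Real.exp (-r ^ 2)
  rw [integral_radial_mul_homogeneous (h := fun x : E 3 => ‖(splitLast 2 x).2‖ ^ k) k hh g]
  congr 1
  have h1 : ∫ x : E 3, Real.exp (-‖x‖ ^ 2) * ‖(splitLast 2 x).2‖ ^ k =
      √Real.pi * (Real.pi * Real.Gamma (k / 2 + 1)) := by
    set F : ℝ × E 2 → ℝ := fun p => Real.exp (-1 * p.1 ^ 2) * (Real.exp (-‖p.2‖ ^ 2) * ‖p.2‖ ^ k)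
    have e : ∀ x : E 3, Real.exp (-‖x‖ ^ 2) * ‖(splitLast 2 x).2‖ ^ k = F (splitLast 2 x) :=
      fun x => by
        rw [norm_sq_splitLast]
        simp only [F]
        rw [← mul_assoc, ← Real.exp_add]
        ring_nf
    have hF : ∫ x : E 3, F (splitLast 2 x) = ∫ p, F p :=
      (measurePreserving_splitLast 2).integral_comp (splitLast 2).measurableEmbedding F
    rw [integral_congr_ae (Eventually.of_forall e), hF]
    rw [Measure.volume_eq_prod, integral_prod_mul (fun t : ℝ => Real.exp (-1 * t ^ 2))
        (fun y : E 2 => Real.exp (-‖y‖ ^ 2) * ‖y‖ ^ k), integral_gaussian, div_one,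
      integral_fun_norm_addHaar volume fun r => Real.exp (-r ^ 2) * r ^ k]
    congr 1
    have hb : volume.real (ball (0 : E 2) 1) = Real.pi := by
      rw [Measure.real, EuclideanSpace.volume_ball_fin_two]
      simp [Real.pi_pos.le]
    have hI : ∫ y in Ioi (0 : ℝ), y ^ (2 - 1) • (Real.exp (-y ^ 2) * y ^ k) =
        1 / 2 * Real.Gamma (k / 2 + 1) := by
      have := integral_pow_mul_exp_neg_sq (k + 1)
      rw [show (((k + 1 : ℕ) : ℝ) + 1) / 2 = k / 2 + 1 by push_cast; ring] at this
      rw [← this]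
      refine setIntegral_congr_fun measurableSet_Ioi fun r _ => ?_
      simp only [smul_eq_mul]
      ring
    rw [finrank_euclideanSpace_fin, hI, hb]
    simp only [nsmul_eq_mul, smul_eq_mul]
    push_cast
    ring
  have h2 : ∫ r in Ioi (0 : ℝ), r ^ (3 - 1) * (r ^ k * Real.exp (-r ^ 2)) =
      1 / 2 * Real.Gamma ((k + 3) / 2) := by
    have := integral_pow_mul_exp_neg_sq (k + 2)
    rw [show (((k + 2 : ℕ) : ℝ) + 1) / 2 = (k + 3) / 2 by push_cast; ring] at this
    rw [← this]
    refine setIntegral_congr_fun measurableSet_Ioi fun r _ => ?_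
    ring
  rw [h1, h2] at hG
  have hpos : Real.Gamma (((k : ℝ) + 3) / 2) ≠ 0 := (Real.Gamma_pos_of_pos (by positivity)).ne'
  set a := Real.Gamma ((k : ℝ) / 2 + 1)
  set b := Real.Gamma (((k : ℝ) + 3) / 2)
  field_simp
  linear_combination (-2) * hG

/-- The Gamma quotient `√π Γ(k/2 + 1) / Γ((k + 3)/2)` at `k = 0`. -/
lemma gamma_ratio_zero : √Real.pi * (Real.Gamma (0 / 2 + 1) / Real.Gamma ((0 + 3) / 2)) = 2 := by
  have h : Real.Gamma ((0 + 3) / 2) = 1 / 2 * √Real.pi := by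
    rw [show ((0 : ℝ) + 3) / 2 = 1 / 2 + 1 by norm_num, Real.Gamma_add_one (by norm_num),
      Real.Gamma_one_half_eq]
  have : 0 < √Real.pi := Real.sqrt_pos.2 Real.pi_pos
  rw [h]
  norm_num [Real.Gamma_one]
  field_simp

lemma gamma_ratio_one : √Real.pi * (Real.Gamma (1 / 2 + 1) / Real.Gamma ((1 + 3) / 2)) =
    Real.pi / 2 := by
  have h : Real.Gamma ((1 + 3) / 2) = 1 := by norm_num
  rw [h, Real.Gamma_add_one (by norm_num), Real.Gamma_one_half_eq]
  nlinarith [Real.mul_self_sqrt Real.pi_pos.le]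

/-- This quotient is the Wallis integral of sin^(k+1) over [0, π]; the recursion reaches k = 3, 5, 7
from k = 1. -/
lemma gamma_ratio_add_two {k : ℝ} (hk : 0 ≤ k) :
    √Real.pi * (Real.Gamma ((k + 2) / 2 + 1) / Real.Gamma ((k + 2 + 3) / 2)) =
      (k + 2) / (k + 3) * (√Real.pi * (Real.Gamma (k / 2 + 1) / Real.Gamma ((k + 3) / 2))) := by
  have e1 : Real.Gamma ((k + 2) / 2 + 1) = (k + 2) / 2 * Real.Gamma (k / 2 + 1) := by
    rw [Real.Gamma_add_one (by positivity), show (k + 2) / 2 = k / 2 + 1 by ring]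
  have e2 : Real.Gamma ((k + 2 + 3) / 2) = (k + 3) / 2 * Real.Gamma ((k + 3) / 2) := by
    rw [show (k + 2 + 3) / 2 = (k + 3) / 2 + 1 by ring, Real.Gamma_add_one (by positivity)]
  have hpos : Real.Gamma ((k + 3) / 2) ≠ 0 := (Real.Gamma_pos_of_pos (by positivity)).ne'
  have hk3 : k + 3 ≠ 0 := by positivity
  rw [e1, e2]
  set a := Real.Gamma (k / 2 + 1)
  set b := Real.Gamma ((k + 3) / 2)
  field_simp


/-! ### Bounds for cylinders and balls with radial kernels -/

lemma discMinorant_le {t : ℝ} (ht : 0 ≤ t) : discMinorant t ≤ Real.pi / 4 := by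
  rcases le_total t 1 with h | h
  · have h1 := integral_sqrt_one_sub_sq_le ht h
    have h2 : 0 ≤ ∫ v in t..1, √(1 - v ^ 2) :=
      intervalIntegral.integral_nonneg h fun v _ => Real.sqrt_nonneg _
    linarith
  · exact discMinorant_le_of_one_le h

lemma integral_radial_mul_norm_snd_pow_of_ratio (k : ℕ) {c : ℝ} (g : ℝ → ℝ)
    (hc : √Real.pi * (Real.Gamma (k / 2 + 1) / Real.Gamma ((k + 3) / 2)) = c) :
    ∫ x : E 3, g ‖x‖ * ‖(splitLast 2 x).2‖ ^ k =
      2 * Real.pi * c * ∫ r in Ioi (0 : ℝ), r ^ 2 * (r ^ k * g r) := by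
  rw [integral_radial_mul_norm_snd_pow, ← hc]
  ring

lemma measurable_norm_snd_splitLast (n : ℕ) :
    Measurable fun x : E (n + 1) => ‖(splitLast n x).2‖ :=
  (measurable_snd.comp (splitLast n).measurable).norm

lemma integrable_radial_mul_norm_snd_pow {k : ℕ} {g : ℝ → ℝ} (hg : Measurable g)
    (hi : IntegrableOn (fun r => r ^ 2 * (r ^ k * g r)) (Ioi 0)) :
    Integrable fun x : E 3 => g ‖x‖ * ‖(splitLast 2 x).2‖ ^ k := by
  have h : Integrable fun x : E 3 => ‖x‖ ^ k * g ‖x‖ := by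
    rw [integrable_fun_norm_addHaar volume (f := fun r => r ^ k * g r), finrank_euclideanSpace_fin]
    exact hi
  refine h.mono ?_ (Eventually.of_forall fun x => ?_)
  · exact ((hg.comp measurable_norm).mul
      ((measurable_norm_snd_splitLast 2).pow_const k)).aestronglyMeasurable
  · rw [mul_comm, norm_mul, norm_mul]
    gcongr
    rw [norm_pow, norm_pow, norm_norm, norm_norm]
    gcongr
    exact norm_snd_splitLast_le x

/-- Upper bound for the optimal energy-to-mass ratio of cylinders, for radial kernels, in terms of
moments of the kernel. -/
theorem rhoCyl_le_of_moments {g : ℝ → ℝ} (hg : Measurable g) (hg0 : ∀ r, 0 ≤ r → 0 ≤ g r)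
    (hi : ∀ k : ℕ, IntegrableOn (fun r => r ^ 2 * (r ^ k * g r)) (Ioi 0)) {m : ℕ → ℝ}
    (hm : ∀ k : ℕ, ∫ r in Ioi (0 : ℝ), r ^ 2 * (r ^ k * g r) = m k) {l : ℝ} (hl : 0 < l) :
    rhoCyl (fun x => g ‖x‖) ≤ ENNReal.ofReal (2 / l + 4 * Real.pi * (m 0 - m 1 / (2 * l) +
      m 3 / (8 * (2 * l) ^ 3) + m 5 / (64 * (2 * l) ^ 5) + 35 * m 7 / (2048 * (2 * l) ^ 7))) := by
  have hπ := Real.pi_pos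
  set N : E 3 → ℝ := fun x => ‖(splitLast 2 x).2‖
  set H : E 3 → ℝ := fun x => g ‖x‖ * (1 - 4 / Real.pi * discMinorant (N x / (2 * l)))
  -- Nonnegativity also where the discs no longer meet permits integration over all of ℝ³ without
  -- truncation at |x'| = 2l, so that only full moments occur.
  have hH0 : ∀ x, 0 ≤ H x := fun x => by
    refine mul_nonneg (hg0 _ (norm_nonneg x)) ?_
    have h := discMinorant_le (t := N x / (2 * l)) (by positivity)
    have : 4 / Real.pi * discMinorant (N x / (2 * l)) ≤ 4 / Real.pi * (Real.pi / 4) := by gcongr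
    have e : 4 / Real.pi * (Real.pi / 4) = 1 := by field_simp
    linarith
  have hHeq : ∀ x, H x = g ‖x‖ * N x ^ 0 - 4 / (Real.pi * (2 * l)) * (g ‖x‖ * N x ^ 1) +
      4 / (Real.pi * 6 * (2 * l) ^ 3) * (g ‖x‖ * N x ^ 3) +
      4 / (Real.pi * 40 * (2 * l) ^ 5) * (g ‖x‖ * N x ^ 5) +
      4 / (Real.pi * 32 * (2 * l) ^ 7) * (g ‖x‖ * N x ^ 7) := fun x => by
    simp only [H, discMinorant]
    field_simp
    ring
  have hI : ∀ k : ℕ, Integrable fun x => g ‖x‖ * N x ^ k := fun k =>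
    integrable_radial_mul_norm_snd_pow hg (hi k)
  have hIc : ∀ (c : ℝ) (k : ℕ), Integrable fun x => c * (g ‖x‖ * N x ^ k) := fun c k =>
    (hI k).const_mul c
  have I1 : Integrable fun x => g ‖x‖ * N x ^ 0 - 4 / (Real.pi * (2 * l)) * (g ‖x‖ * N x ^ 1) :=
    (hI 0).sub (hIc _ 1)
  have I3 : Integrable fun x => g ‖x‖ * N x ^ 0 - 4 / (Real.pi * (2 * l)) * (g ‖x‖ * N x ^ 1) +
      4 / (Real.pi * 6 * (2 * l) ^ 3) * (g ‖x‖ * N x ^ 3) := I1.add (hIc _ 3)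
  have I5 : Integrable fun x => g ‖x‖ * N x ^ 0 - 4 / (Real.pi * (2 * l)) * (g ‖x‖ * N x ^ 1) +
      4 / (Real.pi * 6 * (2 * l) ^ 3) * (g ‖x‖ * N x ^ 3) +
      4 / (Real.pi * 40 * (2 * l) ^ 5) * (g ‖x‖ * N x ^ 5) := I3.add (hIc _ 5)
  have hIH : Integrable H :=
    (I5.add (hIc _ 7)).congr (Eventually.of_forall fun x => (hHeq x).symm)
  have r3 := gamma_ratio_add_two (k := 1) (by norm_num)
  have r5 := gamma_ratio_add_two (k := 3) (by norm_num)
  have r7 := gamma_ratio_add_two (k := 5) (by norm_num)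
  rw [gamma_ratio_one] at r3
  norm_num at r3 r5 r7
  rw [r3] at r5
  rw [r5] at r7
  have hint : ∫ x, H x = 4 * Real.pi * (m 0 - m 1 / (2 * l) +
      m 3 / (8 * (2 * l) ^ 3) + m 5 / (64 * (2 * l) ^ 5) + 35 * m 7 / (2048 * (2 * l) ^ 7)) := by
    have M0 := integral_radial_mul_norm_snd_pow_of_ratio 0 g
      (by simpa using gamma_ratio_zero)
    have M1 := integral_radial_mul_norm_snd_pow_of_ratio 1 g
      (by simpa using gamma_ratio_one)
    have M3 := integral_radial_mul_norm_snd_pow_of_ratio 3 g (by norm_num; exact r3)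
    have M5 := integral_radial_mul_norm_snd_pow_of_ratio 5 g (by norm_num; exact r5)
    have M7 := integral_radial_mul_norm_snd_pow_of_ratio 7 g (by norm_num; exact r7)
    rw [hm] at M0 M1 M3 M5 M7
    rw [integral_congr_ae (Eventually.of_forall hHeq),
      integral_add I5 (hIc _ 7), integral_add I3 (hIc _ 5), integral_add I1 (hIc _ 3),
      integral_sub (hI 0) (hIc _ 1)]
    simp only [integral_const_mul]
    simp only [N]
    rw [M0, M1, M3, M5, M7]
    field_simp
    ring
  have hpos : 0 ≤ ∫ x, H x := integral_nonneg hH0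
  have hgn : Measurable fun x : E 3 => g ‖x‖ := hg.comp measurable_norm
  refine (rhoCyl_le hgn hl).trans ?_
  rw [← hint, ENNReal.ofReal_add (by positivity) hpos]
  gcongr
  rw [ofReal_integral_eq_lintegral_ofReal hIH (Eventually.of_forall hH0)]
  refine lintegral_mono fun x => ?_
  rw [ENNReal.ofReal_mul (hg0 _ (norm_nonneg x))]
  gcongr
  have hl2 : 0 < Real.pi * l ^ 2 := by positivity
  rw [← div_eq_mul_inv]
  refine ENNReal.div_le_of_le_mul ((volume_overlap_disc_le hl _).trans (le_of_eq ?_))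
  rw [← ENNReal.ofReal_mul' hl2.le]
  congr 1
  field_simp
  ring

/-- Lower bound for the energy-to-mass ratio of balls, for radial kernels. -/
theorem le_energyPerMass_ball {g : ℝ → ℝ} (hg : Measurable g) (hg0 : ∀ r, 0 ≤ r → 0 ≤ g r)
    {R : ℝ} (hR : 0 < R) :
    ENNReal.ofReal (3 / R + 4 * Real.pi * ∫ r in Ioc 0 (2 * R),
      r ^ 2 * (g r * (1 - 3 * r / (4 * R) + r ^ 3 / (16 * R ^ 3)))) ≤
      energyPerMass (fun x => g ‖x‖) (ball (0 : E 3) R) := by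
  have hπ := Real.pi_pos
  set p : ℝ → ℝ := fun r => 1 - 3 * r / (4 * R) + r ^ 3 / (16 * R ^ 3)
  set V : ℝ := 4 / 3 * Real.pi * R ^ 3
  have hV : 0 < V := by positivity
  have hp0 : ∀ r, 0 ≤ r → 0 ≤ p r := fun r hr => by
    have : p r = (1 - r / (2 * R)) ^ 2 * (1 + r / (4 * R)) := by
      simp only [p]; field_simp; ring
    rw [this]; positivity
  have hvol : volume (ball (0 : E 3) R) = ENNReal.ofReal V := by
    rw [EuclideanSpace.volume_ball_fin_three, ← ENNReal.ofReal_pow hR.le,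
      ← ENNReal.ofReal_mul (by positivity)]
    congr 1
    simp only [V]; ring
  set f : ℝ → ℝ := (Ioc 0 (2 * R)).indicator fun r => g r * p r
  have hf : Measurable f := by
    refine Measurable.indicator (hg.mul ?_) measurableSet_Ioc
    simp only [p]; fun_prop
  have hf0 : ∀ r, 0 ≤ f r := fun r => indicator_nonneg (fun r hr =>
    mul_nonneg (hg0 r hr.1.le) (hp0 r hr.1.le)) r
  have hint : ∫ x : E 3, f ‖x‖ = 4 * Real.pi * ∫ r in Ioc 0 (2 * R), r ^ 2 * (g r * p r) := by
    have hb : volume.real (ball (0 : E 3) 1) = 4 / 3 * Real.pi := by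
      rw [Measure.real, EuclideanSpace.volume_ball_fin_three, ENNReal.ofReal_one, one_pow, one_mul,
        ENNReal.toReal_ofReal (by positivity)]
      ring
    rw [integral_fun_norm_addHaar volume f, finrank_euclideanSpace_fin, hb]
    have : ∫ y in Ioi (0 : ℝ), y ^ (3 - 1) • f y = ∫ r in Ioc 0 (2 * R), r ^ 2 * (g r * p r) := by
      rw [← integral_indicator measurableSet_Ioi, ← integral_indicator measurableSet_Ioc]
      refine integral_congr_ae (Eventually.of_forall fun r => ?_)
      by_cases h1 : r ∈ Ioc 0 (2 * R)
      · have : r ∈ Ioi (0 : ℝ) := h1.1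
        simp only [f, indicator_of_mem h1, indicator_of_mem this, smul_eq_mul]
      · by_cases h2 : r ∈ Ioi (0 : ℝ) <;> simp [f, h1, h2]
    rw [this]
    simp only [nsmul_eq_mul, smul_eq_mul]
    push_cast
    ring
  have hpos : 0 ≤ ∫ x : E 3, f ‖x‖ := integral_nonneg fun x => hf0 _
  have hinter : ENNReal.ofReal (∫ x : E 3, f ‖x‖) * ENNReal.ofReal V ≤
      interaction (fun x => g ‖x‖) (ball (0 : E 3) R) := by
    have hgn : Measurable fun x : E 3 => g ‖x‖ := hg.comp measurable_norm
    rw [interaction_eq_lintegral_overlap hgn measurableSet_ball,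
      integral_eq_lintegral_of_nonneg_ae (Eventually.of_forall fun x => hf0 _)
        (hf.comp measurable_norm).aestronglyMeasurable]
    -- If the integral diverges, the real-valued one is 0 by convention and the inequality still
    -- holds, so integrability is not needed.
    refine (mul_le_mul_left ENNReal.ofReal_toReal_le _).trans ?_
    rw [← lintegral_mul_const' _ _ ENNReal.ofReal_ne_top]
    refine lintegral_mono fun x => ?_
    by_cases hx : ‖x‖ ∈ Ioc 0 (2 * R)
    · simp only [f, indicator_of_mem hx]
      rw [ENNReal.ofReal_mul (hg0 _ (norm_nonneg x)), mul_assoc]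
      gcongr
      refine le_trans (le_of_eq ?_) (le_volume_overlap_ball hR x hx.2)
      rw [← ENNReal.ofReal_mul' hV.le]
      congr 1
      simp only [p, V]
      field_simp
      ring
    · simp [f, indicator_of_notMem hx]
  rw [← hint, ENNReal.ofReal_add (by positivity) hpos, energyPerMass, energy,
    ENNReal.le_div_iff_mul_le (Or.inl (by rw [hvol]; simpa using hV))
      (Or.inl (by rw [hvol]; exact ENNReal.ofReal_ne_top)), add_mul]
  refine add_le_add ?_ (by rw [hvol]; exact hinter)
  exact_mod_cast le_perimeter_ball (n := 3) hR

lemma le_rhoBall {g : ℝ → ℝ} (hg : Measurable g) (hg0 : ∀ r, 0 ≤ r → 0 ≤ g r) {τ : ℝ}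
    (h : ∀ R : ℝ, 0 < R → τ ≤ 3 / R + 4 * Real.pi * ∫ r in Ioc 0 (2 * R),
      r ^ 2 * (g r * (1 - 3 * r / (4 * R) + r ^ 3 / (16 * R ^ 3)))) :
    ENNReal.ofReal τ ≤ rhoBall (n := 3) fun x => g ‖x‖ :=
  le_iInf₂ fun R hR => (ENNReal.ofReal_le_ofReal (h R hR)).trans (le_energyPerMass_ball hg hg0 hR)


/-- A Bochner integral is 0 by convention when the function is not integrable, so evaluating a
moment to a positive number already proves its integrability. -/
lemma integrableOn_of_integral_ne_zero {f : ℝ → ℝ} {s : Set ℝ} (h : ∫ x in s, f x ≠ 0) :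
    IntegrableOn f s := by
  by_contra hf
  exact h (integral_undef hf)

/-! ### The truncated Coulomb kernel -/

/-- The radial profile of the truncated Coulomb kernel. -/
def truncatedCoulombProfile (κ : ℝ) : ℝ → ℝ := (Iio κ).indicator fun r => r⁻¹

lemma truncatedCoulomb_eq (κ : ℝ) :
    truncatedCoulomb κ = fun x => truncatedCoulombProfile κ ‖x‖ := by
  funext x
  by_cases h : ‖x‖ < κ <;> simp [truncatedCoulomb, truncatedCoulombProfile, h]

lemma measurable_truncatedCoulombProfile (κ : ℝ) : Measurable (truncatedCoulombProfile κ) :=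
  measurable_inv.indicator measurableSet_Iio

lemma truncatedCoulombProfile_nonneg (κ : ℝ) (r : ℝ) (hr : 0 ≤ r) :
    0 ≤ truncatedCoulombProfile κ r :=
  indicator_apply_nonneg fun _ => inv_nonneg.2 hr

lemma measurable_truncatedCoulomb (κ : ℝ) : Measurable (truncatedCoulomb κ) := by
  rw [truncatedCoulomb_eq]
  exact (measurable_truncatedCoulombProfile κ).comp measurable_norm

lemma moment_truncatedCoulombProfile {κ : ℝ} (hκ : 0 < κ) (k : ℕ) :
    ∫ r in Ioi (0 : ℝ), r ^ 2 * (r ^ k * truncatedCoulombProfile κ r) = κ ^ (k + 2) / (k + 2) := by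
  have h : ∀ r ∈ Ioi (0 : ℝ), r ^ 2 * (r ^ k * truncatedCoulombProfile κ r) =
      (Iio κ).indicator (fun r => r ^ (k + 1)) r := fun r hr => by
    have hr0 : r ≠ 0 := (mem_Ioi.1 hr).ne'
    by_cases h : r ∈ Iio κ
    · simp only [truncatedCoulombProfile, indicator_of_mem h]
      field_simp
      ring
    · simp [truncatedCoulombProfile, indicator_of_notMem h]
  rw [setIntegral_congr_fun measurableSet_Ioi h, setIntegral_indicator measurableSet_Iio,
    Ioi_inter_Iio, ← integral_Ioc_eq_integral_Ioo, ← intervalIntegral.integral_of_le hκ.le,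
    integral_pow]
  push_cast
  simp
  ring

lemma integral_truncatedCoulombProfile_ball {κ R : ℝ} (hκ : 0 < κ) (hR : 0 < R) {c : ℝ}
    (hc : c = min κ (2 * R)) :
    ∫ r in Ioc 0 (2 * R), r ^ 2 * (truncatedCoulombProfile κ r *
      (1 - 3 * r / (4 * R) + r ^ 3 / (16 * R ^ 3))) =
      c ^ 2 / 2 - c ^ 3 / (4 * R) + c ^ 5 / (80 * R ^ 3) := by
  have hc0 : 0 < c := by rw [hc]; positivity
  have h : ∀ r ∈ Ioc 0 (2 * R), r ^ 2 * (truncatedCoulombProfile κ r *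
      (1 - 3 * r / (4 * R) + r ^ 3 / (16 * R ^ 3))) =
      (Iio κ).indicator (fun r => r - 3 / (4 * R) * r ^ 2 + 1 / (16 * R ^ 3) * r ^ 4) r :=
    fun r hr => by
      have hr0 : r ≠ 0 := hr.1.ne'
      by_cases h : r ∈ Iio κ
      · simp only [truncatedCoulombProfile, indicator_of_mem h]
        field_simp
      · simp [truncatedCoulombProfile, indicator_of_notMem h]
  have hset : (Ioc 0 (2 * R) ∩ Iio κ : Set ℝ) =ᵐ[volume] Ioc 0 c := by
    refine (ae_eq_set_inter (Filter.EventuallyEq.refl _ _) Iio_ae_eq_Iic).trans ?_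
    rw [Ioc_inter_Iic, hc, min_comm]
    exact Filter.EventuallyEq.refl _ _
  rw [setIntegral_congr_fun measurableSet_Ioc h, setIntegral_indicator measurableSet_Iio,
    setIntegral_congr_set hset, ← intervalIntegral.integral_of_le hc0.le,
    intervalIntegral.integral_add, intervalIntegral.integral_sub]
  · simp only [intervalIntegral.integral_const_mul, integral_pow, integral_id]
    norm_num
    field_simp
    ring
  all_goals exact Continuous.intervalIntegrable (by fun_prop) _ _

/-- The radius is l = κ/2: then 2l = κ and every ratio κ/(2l) in the moment bound is 1. -/
theorem rhoCyl_truncatedCoulomb_le :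
    rhoCyl (truncatedCoulomb (11 / 10)) ≤ ENNReal.ofReal 6.615 := by
  have hm := moment_truncatedCoulombProfile (κ := 11 / 10) (by norm_num)
  rw [truncatedCoulomb_eq]
  refine (rhoCyl_le_of_moments (measurable_truncatedCoulombProfile _)
    (truncatedCoulombProfile_nonneg _) (fun k => integrableOn_of_integral_ne_zero ?_)
    (m := fun k => (11 / 10 : ℝ) ^ (k + 2) / (k + 2)) hm (l := 11 / 20) (by norm_num)).trans ?_
  · rw [hm]; positivity
  · apply ENNReal.ofReal_le_ofReal
    have := Real.pi_lt_d4
    norm_num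
    linarith

/-- If 2R ≥ κ the bound is a cubic in u = 1/R. If 2R ≤ κ the truncation is invisible and the bound
is 3/R + (8π/5) R², for which π ≥ 3 is enough. -/
theorem le_rhoBall_truncatedCoulomb :
    ENNReal.ofReal 6.616 ≤ rhoBall (truncatedCoulomb (11 / 10)) := by
  rw [truncatedCoulomb_eq]
  refine le_rhoBall (measurable_truncatedCoulombProfile _) (truncatedCoulombProfile_nonneg _)
    fun R hR => ?_
  have hπ := Real.pi_gt_d4
  rcases le_total (11 / 10) (2 * R) with h | h
  · rw [integral_truncatedCoulombProfile_ball (by norm_num) hR (min_eq_left h).symm]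
    obtain ⟨u, hu, rfl⟩ : ∃ u : ℝ, 0 < u ∧ R = u⁻¹ := ⟨R⁻¹, inv_pos.2 hR, (inv_inv R).symm⟩
    have e : (11 / 10 : ℝ) ^ 2 / 2 - (11 / 10) ^ 3 / (4 * u⁻¹) + (11 / 10) ^ 5 / (80 * u⁻¹ ^ 3) =
        0.605 - 0.33275 * u + 0.020131375 * u ^ 3 := by
      field_simp
      ring
    rw [e, div_inv_eq_mul]
    -- (u - a)² (u + 2a) ≥ 0 is the tangent-line inequality for u³ at a, here with a near the
    -- minimiser. The sign of this factor allows π to be replaced by a lower bound.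
    have hJ : 0 ≤ 0.605 - 0.33275 * u + 0.020131375 * u ^ 3 := by
      nlinarith [mul_nonneg (sq_nonneg (u - 2.3)) (by linarith : 0 ≤ u + 4.6)]
    have h1 : 4 * 3.1415 * (0.605 - 0.33275 * u + 0.020131375 * u ^ 3) ≤
        4 * Real.pi * (0.605 - 0.33275 * u + 0.020131375 * u ^ 3) := by gcongr
    -- 1.2476 approximates the critical point of the full cubic, perimeter term included.
    nlinarith [mul_nonneg (sq_nonneg (u - 1.2476)) (by linarith : 0 ≤ u + 2.4952)]
  · rw [integral_truncatedCoulombProfile_ball (by norm_num) hR (min_eq_right h).symm]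
    have e : (2 * R) ^ 2 / 2 - (2 * R) ^ 3 / (4 * R) + (2 * R) ^ 5 / (80 * R ^ 3) =
        2 / 5 * R ^ 2 := by
      field_simp
      ring
    rw [e]
    have h1 : 4 * 3 * (2 / 5 * R ^ 2) ≤ 4 * Real.pi * (2 / 5 * R ^ 2) := by
      gcongr; linarith
    refine le_trans ?_ (add_le_add_right h1 _)
    rw [← sub_nonneg]
    have e2 : 3 / R + 4 * 3 * (2 / 5 * R ^ 2) - 6.616 = (3 + 4.8 * R ^ 3 - 6.616 * R) / R := by
      field_simp
      ring
    rw [e2]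
    refine div_nonneg ?_ hR.le
    nlinarith [mul_nonneg (sq_nonneg (R - 0.55)) (by linarith : 0 ≤ R + 1.1)]

theorem rhoCyl_lt_rhoBall_truncatedCoulomb :
    rhoCyl (truncatedCoulomb (11 / 10)) < rhoBall (truncatedCoulomb (11 / 10)) :=
  (rhoCyl_truncatedCoulomb_le.trans_lt
    ((ENNReal.ofReal_lt_ofReal_iff (by norm_num)).2 (by norm_num))).trans_le
    le_rhoBall_truncatedCoulomb

/-! ### The Yukawa kernel -/

/-- The radial profile of the Yukawa kernel. -/
def yukawaProfile (κ r : ℝ) : ℝ := Real.exp (-r / κ) * r⁻¹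

lemma yukawa_eq (κ : ℝ) : yukawa κ = fun x => yukawaProfile κ ‖x‖ := rfl

lemma measurable_yukawaProfile (κ : ℝ) : Measurable (yukawaProfile κ) := by
  unfold yukawaProfile
  fun_prop

lemma yukawaProfile_nonneg (κ : ℝ) (r : ℝ) (hr : 0 ≤ r) : 0 ≤ yukawaProfile κ r := by
  unfold yukawaProfile
  positivity

lemma measurable_yukawa (κ : ℝ) : Measurable (yukawa κ) := by
  rw [yukawa_eq]
  exact (measurable_yukawaProfile κ).comp measurable_norm

lemma moment_yukawaProfile {κ : ℝ} (hκ : 0 < κ) (k : ℕ) :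
    ∫ r in Ioi (0 : ℝ), r ^ 2 * (r ^ k * yukawaProfile κ r) = κ ^ (k + 2) * (k + 1).factorial := by
  have h := Real.integral_rpow_mul_exp_neg_mul_Ioi (a := (k + 1 : ℕ) + 1) (r := κ⁻¹)
    (by positivity) (by positivity)
  rw [Real.Gamma_nat_eq_factorial, one_div, inv_inv] at h
  have e : κ ^ (((k + 1 : ℕ) : ℝ) + 1) = κ ^ (k + 2) := by
    rw [← Real.rpow_natCast]; push_cast; ring_nf
  rw [e] at h
  rw [← h]
  refine setIntegral_congr_fun measurableSet_Ioi fun r hr => ?_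
  have hr0 : r ≠ 0 := (mem_Ioi.1 hr).ne'
  simp only [add_sub_cancel_right, Real.rpow_natCast, yukawaProfile]
  rw [show -r / κ = -(κ⁻¹ * r) by ring]
  field_simp
  ring

lemma integral_yukawaProfile_ball {κ R : ℝ} (hκ : 0 < κ) (hR : 0 < R) :
    ∫ r in Ioc 0 (2 * R), r ^ 2 * (yukawaProfile κ r *
      (1 - 3 * r / (4 * R) + r ^ 3 / (16 * R ^ 3))) =
      (κ ^ 2 - 3 * κ ^ 3 / (2 * R) + 3 * κ ^ 5 / (2 * R ^ 3)) - Real.exp (-(2 * R) / κ) *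
        (3 * κ ^ 3 / (2 * R) + 3 * κ ^ 4 / R ^ 2 + 3 * κ ^ 5 / (2 * R ^ 3)) := by
  have h : ∀ r ∈ Ioc 0 (2 * R), r ^ 2 * (yukawaProfile κ r *
      (1 - 3 * r / (4 * R) + r ^ 3 / (16 * R ^ 3))) =
      Real.exp (-r / κ) * (r - 3 / (4 * R) * r ^ 2 + 1 / (16 * R ^ 3) * r ^ 4) :=
    fun r hr => by
      have hr0 : r ≠ 0 := hr.1.ne'
      simp only [yukawaProfile]
      field_simp
  rw [setIntegral_congr_fun measurableSet_Ioc h,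
    ← intervalIntegral.integral_of_le (by positivity),
    intervalIntegral.integral_eq_sub_of_hasDerivAt (f := fun r => Real.exp (-r / κ) *
      (-((κ * r + κ ^ 2) - 3 / (4 * R) * (κ * r ^ 2 + 2 * κ ^ 2 * r + 2 * κ ^ 3) +
        1 / (16 * R ^ 3) * (κ * r ^ 4 + 4 * κ ^ 2 * r ^ 3 + 12 * κ ^ 3 * r ^ 2 + 24 * κ ^ 4 * r +
          24 * κ ^ 5))))]
  · simp only [neg_zero, zero_div, Real.exp_zero]
    field_simp
    ring
  · intro r _
    have h1 : HasDerivAt (fun r => Real.exp (-r / κ)) (Real.exp (-r / κ) * (-1 / κ)) r :=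
      ((hasDerivAt_id' r).neg.div_const κ).exp
    have hp := fun n : ℕ => hasDerivAt_pow n r
    have h2 := ((((hasDerivAt_id' r).const_mul κ).add_const (κ ^ 2)).sub
      (((((hp 2).const_mul κ).add ((hasDerivAt_id' r).const_mul (2 * κ ^ 2))).add_const
        (2 * κ ^ 3)).const_mul (3 / (4 * R)))).add
      ((((((((hp 4).const_mul κ).add ((hp 3).const_mul (4 * κ ^ 2))).add
        ((hp 2).const_mul (12 * κ ^ 3))).add ((hasDerivAt_id' r).const_mul (24 * κ ^ 4))).add_const
        (24 * κ ^ 5))).const_mul (1 / (16 * R ^ 3)))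
    refine (h1.mul h2.neg).congr_deriv ?_
    simp only [Pi.add_apply, Pi.sub_apply, Pi.neg_apply]
    field_simp
    push_cast
    ring
  · exact Continuous.intervalIntegrable (by fun_prop) _ _

/-- With l = 4κ every ratio κ/(2l) is 1/8, so the factorials in the moments are damped by powers of
8. The small margin requires six digits of π. -/
theorem rhoCyl_yukawa_le : rhoCyl (yukawa (56 / 100)) ≤ ENNReal.ofReal 3.8743 := by
  have hm := moment_yukawaProfile (κ := 56 / 100) (by norm_num)
  rw [yukawa_eq]
  refine (rhoCyl_le_of_moments (measurable_yukawaProfile _)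
    (yukawaProfile_nonneg _) (fun k => integrableOn_of_integral_ne_zero ?_)
    (m := fun k => (56 / 100 : ℝ) ^ (k + 2) * (k + 1).factorial) hm (l := 4 * (56 / 100))
    (by norm_num)).trans ?_
  · rw [hm]; positivity
  · apply ENNReal.ofReal_le_ofReal
    have := Real.pi_lt_d6
    norm_num [Nat.factorial]
    linarith

/-- The quadratic is 3 (y + 2)², whose growth from a to a + w is dominated by 1 + w + w²/2 ≤ exp w.
-/
lemma exp_neg_mul_quadratic_le {a y : ℝ} (ha : 0 ≤ a) (hy : a ≤ y) :
    Real.exp (-y) * (3 * y ^ 2 + 12 * y + 12) ≤ Real.exp (-a) * (3 * a ^ 2 + 12 * a + 12) := by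
  obtain ⟨w, hw, rfl⟩ : ∃ w, 0 ≤ w ∧ y = a + w := ⟨y - a, by linarith, by ring⟩
  have h1 : 3 * (a + w) ^ 2 + 12 * (a + w) + 12 ≤
      (3 * a ^ 2 + 12 * a + 12) * Real.exp w := by
    have h := Real.quadratic_le_exp_of_nonneg hw
    have h2 : (3 * a ^ 2 + 12 * a + 12) * (1 + w + w ^ 2 / 2) ≤
      (3 * a ^ 2 + 12 * a + 12) * Real.exp w := by gcongr
    refine le_trans ?_ h2
    nlinarith [mul_nonneg ha hw, mul_nonneg (mul_nonneg ha hw) ha, mul_nonneg (sq_nonneg a)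
      (sq_nonneg w), mul_nonneg ha (sq_nonneg w), sq_nonneg w]
  calc Real.exp (-(a + w)) * (3 * (a + w) ^ 2 + 12 * (a + w) + 12)
      ≤ Real.exp (-(a + w)) * ((3 * a ^ 2 + 12 * a + 12) * Real.exp w) := by gcongr
    _ = (Real.exp (-(a + w)) * Real.exp w) * (3 * a ^ 2 + 12 * a + 12) := by ring
    _ = _ := by rw [← Real.exp_add]; congr 2; ring

lemma exp_neg_natCast_le (n : ℕ) : Real.exp (-n) ≤ (2.718 ^ n)⁻¹ := by
  rw [Real.exp_neg, ← Real.exp_one_pow]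
  have := Real.exp_one_gt_d9
  gcongr
  linarith

/-- With y = 2R/κ, this is the ball inequality multiplied by y³, with rounded coefficients. On each
of three ranges the exponential term is replaced by its value at an integer to the left, leaving a
polynomial inequality. -/
lemma yukawa_tail_le {y : ℝ} (hy : 5 / 2 ≤ y) :
    3.95 * (Real.exp (-y) * (3 * y ^ 2 + 12 * y + 12)) ≤
      0.06641 * y ^ 3 - 1.10817 * y ^ 2 + 47.2897 := by
  rcases le_total y 5 with h5 | h5
  · have h := exp_neg_mul_quadratic_le (a := 2) (by norm_num) (by linarith : (2 : ℝ) ≤ y)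
    have he := exp_neg_natCast_le 2
    norm_num at he h
    have h2 : (5 - y) * (y - 5 / 2) ≥ 0 := mul_nonneg (by linarith) (by linarith)
    nlinarith [mul_nonneg h2 (by linarith : 0 ≤ y)]
  rcases le_total y 8 with h8 | h8
  · have h := exp_neg_mul_quadratic_le (a := 5) (by norm_num) h5
    have he := exp_neg_natCast_le 5
    norm_num at he h
    have h2 : (8 - y) * (y - 5) ≥ 0 := mul_nonneg (by linarith) (by linarith)
    nlinarith [mul_nonneg h2 (by linarith : 0 ≤ y)]
  · have h := exp_neg_mul_quadratic_le (a := 8) (by norm_num) h8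
    have he := exp_neg_natCast_le 8
    norm_num at he h
    -- 11.125 approximates the critical point of the cubic on the right, which lies in this range.
    nlinarith [mul_nonneg (sq_nonneg (y - 11.125)) (by linarith : 0 ≤ y + 5.5625)]

theorem le_rhoBall_yukawa : ENNReal.ofReal 3.8744 ≤ rhoBall (yukawa (56 / 100)) := by
  rw [yukawa_eq]
  refine le_rhoBall (measurable_yukawaProfile _) (yukawaProfile_nonneg _) fun R hR => ?_
  have hπ := Real.pi_gt_d6
  have hJ0 : 0 ≤ ∫ r in Ioc 0 (2 * R), r ^ 2 * (yukawaProfile (56 / 100) r *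
      (1 - 3 * r / (4 * R) + r ^ 3 / (16 * R ^ 3))) := by
    refine setIntegral_nonneg measurableSet_Ioc fun r hr => ?_
    have h0 := yukawaProfile_nonneg (56 / 100) r hr.1.le
    have hr0 := hr.1.le
    have e : 1 - 3 * r / (4 * R) + r ^ 3 / (16 * R ^ 3) =
        (1 - r / (2 * R)) ^ 2 * (1 + r / (4 * R)) := by
      field_simp
      ring
    rw [e]
    positivity
  rw [integral_yukawaProfile_ball (by norm_num) hR] at hJ0 ⊢
  obtain ⟨y, hy, rfl⟩ : ∃ y : ℝ, 0 < y ∧ R = 0.28 * y := ⟨R / 0.28, by positivity, by ring⟩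
  set J := ((56 / 100 : ℝ) ^ 2 - 3 * (56 / 100) ^ 3 / (2 * (0.28 * y)) +
    3 * (56 / 100) ^ 5 / (2 * (0.28 * y) ^ 3)) - Real.exp (-(2 * (0.28 * y)) / (56 / 100)) *
      (3 * (56 / 100) ^ 3 / (2 * (0.28 * y)) + 3 * (56 / 100) ^ 4 / (0.28 * y) ^ 2 +
        3 * (56 / 100) ^ 5 / (2 * (0.28 * y) ^ 3)) with hJ
  have hJπ : 4 * 3.141592 * J ≤ 4 * Real.pi * J := by gcongr
  -- For y ≤ 5/2 the perimeter term alone exceeds the target, as 3/0.7 > 3.8744.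
  rcases le_total y (5 / 2) with h | h
  · have h1 : 3.8744 ≤ 3 / (0.28 * y) := by
      rw [le_div_iff₀ (by positivity)]
      linarith
    have : 0 ≤ 4 * Real.pi * J := by positivity
    linarith
  · have hJy : J = 0.3136 / y ^ 3 *
        (y ^ 3 - 3 * y ^ 2 + 12 - Real.exp (-y) * (3 * y ^ 2 + 12 * y + 12)) := by
      rw [hJ, show -(2 * (0.28 * y)) / (56 / 100) = -y by ring]
      field_simp
      ring
    refine le_trans ?_ (add_le_add_right hJπ _)
    have htail := yukawa_tail_le h
    have hX : 0 ≤ Real.exp (-y) * (3 * y ^ 2 + 12 * y + 12) := by positivity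
    set X := Real.exp (-y) * (3 * y ^ 2 + 12 * y + 12)
    have e2 : 3 / (0.28 * y) + 4 * 3.141592 * J - 3.8744 =
        (3 / 0.28 * y ^ 2 + 4 * 3.141592 * 0.3136 * (y ^ 3 - 3 * y ^ 2 + 12 - X)
          - 3.8744 * y ^ 3) / y ^ 3 := by
      rw [hJy]
      field_simp
    rw [← sub_nonneg, e2]
    refine div_nonneg ?_ (by positivity)
    have : 0 < y ^ 3 := by positivity
    have : 0 < y ^ 2 := by positivity
    linarith

theorem rhoCyl_lt_rhoBall_yukawa :
    rhoCyl (yukawa (56 / 100)) < rhoBall (yukawa (56 / 100)) :=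
  (rhoCyl_yukawa_le.trans_lt
    ((ENNReal.ofReal_lt_ofReal_iff (by norm_num)).2 (by norm_num))).trans_le le_rhoBall_yukawa

end LiquidDrop

end

theorem proposition1 :
    -- the limits that define the ratios of infinite cylinders exist
    (∀ κ : ℝ, 0 < κ → ∀ l : ℝ, 0 < l →
      Tendsto
        (fun L : ℝ => LiquidDrop.energyPerMass (LiquidDrop.truncatedCoulomb κ)
          (LiquidDrop.cylinder l L))
        atTop (𝓝 (LiquidDrop.sigmaCyl (LiquidDrop.truncatedCoulomb κ) l)) ∧
      Tendsto
        (fun L : ℝ => LiquidDrop.energyPerMass (LiquidDrop.yukawa κ) (LiquidDrop.cylinder l L))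
        atTop (𝓝 (LiquidDrop.sigmaCyl (LiquidDrop.yukawa κ) l))) ∧
    -- for each of the two families, cylinders beat balls for some cut-length
    (∃ κ : ℝ, 0 < κ ∧
      LiquidDrop.rhoCyl (LiquidDrop.truncatedCoulomb κ) <
        LiquidDrop.rhoBall (LiquidDrop.truncatedCoulomb κ)) ∧
    (∃ κ : ℝ, 0 < κ ∧
      LiquidDrop.rhoCyl (LiquidDrop.yukawa κ) < LiquidDrop.rhoBall (LiquidDrop.yukawa κ)) ∧
    -- explicit cut-lengths
    LiquidDrop.rhoCyl (LiquidDrop.truncatedCoulomb (11 / 10)) <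
      LiquidDrop.rhoBall (LiquidDrop.truncatedCoulomb (11 / 10)) ∧
    LiquidDrop.rhoCyl (LiquidDrop.yukawa (56 / 100)) <
      LiquidDrop.rhoBall (LiquidDrop.yukawa (56 / 100)) := by
  refine ⟨fun κ _ l hl => ⟨LiquidDrop.tendsto_sigmaCyl (LiquidDrop.measurable_truncatedCoulomb κ) hl,
    LiquidDrop.tendsto_sigmaCyl (LiquidDrop.measurable_yukawa κ) hl⟩,
    ⟨11 / 10, by norm_num, LiquidDrop.rhoCyl_lt_rhoBall_truncatedCoulomb⟩,
    ⟨56 / 100, by norm_num, LiquidDrop.rhoCyl_lt_rhoBall_yukawa⟩,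
    LiquidDrop.rhoCyl_lt_rhoBall_truncatedCoulomb, LiquidDrop.rhoCyl_lt_rhoBall_yukawa⟩
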